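/- Let $S_1,\dots,S_m$ be invertible affine maps of $\mathbb R^2$, each a contraction (Lipschitz constant $<1$) for the Euclidean metric, and suppose that their attractor, i.e. the nonempty compact set $\gamma$ with $\gamma=\bigcup_{i=1}^m S_i(\gamma)$, is a Jordan arc (the image of $[0,1]$ under an injective continuous map). For a nonempty word $\mathbf i=i_1\dots i_k$ over $\{1,\dots,m\}$ put $S_{\mathbf i}=S_{i_1}\circ\dots\circ S_{i_k}$, and let $$\mathcal F=\{S_{\mathbf j}^{-1}\circ S_{\mathbf i} : \mathbf i,\mathbf j \text{ nonempty words with } i_1\ne j_1\}$$ be the associated family. If there is a sequence $f_n\in\mathcal F\setminus\{\mathrm{Id}\}$ with $f_n\to\mathrm{Id}$ (pointwise on $\mathbb R^2$, equivalently in the coefficients) and $f_n(\gamma)\cap\gamma\neq\varnothing$ for all $n$, then $\gamma$ is a parabolic segment, that is, either a non-degenerate compact arc of a parabola or a non-degenerate straight line segment. -/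

import Mathlib

/-- The Euclidean plane. -/
abbrev Plane : Type := EuclideanSpace ℝ (Fin 2)

/-- A (non-degenerate) Jordan arc: the image of `[0,1]` under an injective continuous map. -/
def IsJordanArc (γ : Set Plane) : Prop :=
  ∃ c : unitInterval → Plane, Continuous c ∧ Function.Injective c ∧ Set.range c = γ

/-- `K` is the attractor of the finite system `S`: a nonempty compact set with
`K = ⋃ i, S i (K)` (it is unique if the maps are contractions). -/
def IsAttractor {m : ℕ} (S : Fin m → (Plane ≃ᵃ[ℝ] Plane)) (K : Set Plane) : Prop :=
  K.Nonempty ∧ IsCompact K ∧ K = ⋃ i, (S i) '' K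

/-- For a word `w = i₁ i₂ … iₙ`, the composition `S_w = S_{i₁} ∘ S_{i₂} ∘ … ∘ S_{iₙ}`. -/
noncomputable def wordMap {m : ℕ} (S : Fin m → (Plane ≃ᵃ[ℝ] Plane)) (w : List (Fin m)) :
    Plane ≃ᵃ[ℝ] Plane :=
  (w.map S).prod

/-- The associated family of `S`: all maps `S_j⁻¹ ∘ S_i`, where `i`, `j` are nonempty words
with different first letters. -/
def associatedFamily {m : ℕ} (S : Fin m → (Plane ≃ᵃ[ℝ] Plane)) :
    Set (Plane ≃ᵃ[ℝ] Plane) :=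
  {f | ∃ (i₁ j₁ : Fin m) (i j : List (Fin m)), i₁ ≠ j₁ ∧
    f = (wordMap S (j₁ :: j))⁻¹ * wordMap S (i₁ :: i)}

/-- A non-degenerate straight line segment. -/
def IsLineSegment (γ : Set Plane) : Prop :=
  ∃ p q : Plane, p ≠ q ∧ γ = segment ℝ p q

/-- A compact non-degenerate arc of a (non-degenerate) parabola; every parabola has a
parametrization `t ↦ p + t u + t² v` with `u`, `v` linearly independent, and every such curve
is a parabola. -/
def IsParabolaArc (γ : Set Plane) : Prop :=
  ∃ p u v : Plane, LinearIndependent ℝ ![u, v] ∧ ∃ a b : ℝ, a < b ∧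
    γ = (fun t : ℝ => p + t • u + t ^ 2 • v) '' Set.Icc a b

/-- A parabolic segment: an arc of a parabola or, as the degenerate case, a straight line
segment. -/
def IsParabolicSegment (γ : Set Plane) : Prop :=
  IsParabolaArc γ ∨ IsLineSegment γ

/-! Identify the plane with ℂ and parametrise `γ` by `φ`. A map `f n = S_j⁻¹ ∘ S_i` close to the
identity is the time-`ε n` map of an affine vector field; after normalisation and passage to a
subsequence the fields converge to some `X ≠ 0` and `ε n → 0` (`exists_generators`). Suppose `γ` is
not contained in a line. The main point is that `γ` contains a piece of a flow line of an affine
field (`inLine_or_hasOrbitSubarc`).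

Shift: if `f n (φ (1/2))` lies in `γ` infinitely often, then `f n` moves the whole middle part of
`γ` along `γ`. Iterating it and letting `n → ∞` puts a piece of a flow line of `X` into `γ`.

Fold: otherwise `f n` moves the middle part off `γ`, although `f n (γ)` still meets `γ`. Then the
subarcs `S_i γ` and `S_j γ` are run through by `S_i ∘ φ` and `S_j ∘ φ` in opposite directions. A
winding argument shows that an arc moved off itself by arbitrarily small flow maps cannot cross the
flow lines in both directions (`false_of_opposite_crossing`). Pull `X` back by `S_j`, normalise, and
let `X'` be a limit. If `φ` crossed the flow lines of `X'`, the nearby arcs `φ` and `f n ∘ φ` would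
cross those of the pulled-back field in the same direction; as `S_j⁻¹ γ` contains both, oppositely
oriented, it would cross them in both directions. So `φ` locally follows a flow line of `X'`.

Self-similarity then makes all of `γ` an arc of a flow line (`exists_eq_orbit`), which some affine
map sends properly into itself. Comparing derivatives of this self-map (`rate_eq`) forces `det = 2
tr² / 9` for the linear part: it is nilpotent or has eigenvalues `κ, 2κ`, and the nondegenerate flow
lines are parabolas. -/

noncomputable section
open Filter Topology Set Metric

/-! ### One-parameter groups of bounded operators. -/

section OneParameterGroup

variable {V : Type*} [NormedAddCommGroup V] [NormedSpace ℝ V]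

/-- The one-parameter group generated by a bounded operator. -/
def expGroup (M : V →L[ℝ] V) (t : ℝ) : V →L[ℝ] V := NormedSpace.exp (t • M)

lemma expGroup_zero (M : V →L[ℝ] V) : expGroup M 0 = 1 := by
  simp [expGroup]

lemma expGroup_smul (M : V →L[ℝ] V) (c t : ℝ) : expGroup (c • M) t = expGroup M (t * c) := by
  simp [expGroup, smul_smul]

variable [CompleteSpace V]

lemma expGroup_add_apply (M : V →L[ℝ] V) (s t : ℝ) (w : V) :
    expGroup M (s + t) w = expGroup M s (expGroup M t w) := by
  let _ : NormedAlgebra ℚ (V →L[ℝ] V) := NormedAlgebra.restrictScalars ℚ ℝ _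
  rw [expGroup, add_smul, NormedSpace.exp_add_of_commute
    (((Commute.refl M).smul_left s).smul_right t)]
  rfl

lemma hasDerivAt_expGroup (M : V →L[ℝ] V) (w : V) (t : ℝ) :
    HasDerivAt (fun t : ℝ => expGroup M t w) (M (expGroup M t w)) t := by
  have h := (hasDerivAt_exp_smul_const' (𝕂 := ℝ) M t).clm_apply (hasDerivAt_const t w)
  refine h.congr_deriv ?_
  simp [expGroup]

/-- Variation of constants: the twisted curve is stationary when `c' = M c`, which yields uniqueness
of solutions. -/
lemma hasDerivAt_expGroup_neg (M : V →L[ℝ] V) {c : ℝ → V} {c' : V} {t : ℝ}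
    (hc : HasDerivAt c c' t) :
    HasDerivAt (fun t : ℝ => expGroup M (-t) (c t)) (expGroup M (-t) (c' - M (c t))) t := by
  have h1 : HasDerivAt (fun t : ℝ => NormedSpace.exp ((-t) • M))
      (-(NormedSpace.exp ((-t) • M) * M)) t := by
    have := (hasDerivAt_exp_smul_const (𝕂 := ℝ) M (-t)).scomp t (hasDerivAt_neg t)
    rw [neg_one_smul] at this
    exact this
  refine (h1.clm_apply hc).congr_deriv ?_
  simp only [neg_apply, mul_apply_eq_comp, map_sub, expGroup]
  abel

lemma continuous_expGroup : Continuous fun q : (V →L[ℝ] V) × ℝ => expGroup q.1 q.2 := by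
  let _ : NormedAlgebra ℚ (V →L[ℝ] V) := NormedAlgebra.restrictScalars ℚ ℝ _
  exact NormedSpace.exp_continuous.comp (by fun_prop)

/-- At time 0 the exponential is `1` whatever the operator, so only the time variable contributes.
-/
lemma hasStrictFDerivAt_expGroup_zero (M : V →L[ℝ] V) :
    HasStrictFDerivAt (fun q : (V →L[ℝ] V) × ℝ => expGroup q.1 q.2)
      ((ContinuousLinearMap.snd ℝ (V →L[ℝ] V) ℝ).smulRight M) (M, 0) := by
  have h1 : HasStrictFDerivAt (fun q : (V →L[ℝ] V) × ℝ => q.2 • q.1) _ (M, 0) :=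
    HasStrictFDerivAt.smul (𝕜 := ℝ) (𝕜' := ℝ) hasStrictFDerivAt_snd hasStrictFDerivAt_fst
  have h2 : HasStrictFDerivAt NormedSpace.exp (1 : (V →L[ℝ] V) →L[ℝ] _)
      ((fun q : (V →L[ℝ] V) × ℝ => q.2 • q.1) (M, 0)) := by
    simp only [zero_smul]; exact hasStrictFDerivAt_exp_zero
  refine (HasStrictFDerivAt.comp (f := fun q : (V →L[ℝ] V) × ℝ => q.2 • q.1) (M, (0 : ℝ)) h2 h1).congr_fderiv ?_
  refine ContinuousLinearMap.ext fun q => ?_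
  simp

lemma hasStrictFDerivAt_expGroup_one :
    HasStrictFDerivAt (𝕜 := ℝ) (fun M : V →L[ℝ] V => expGroup M 1) 1 0 := by
  simpa [expGroup] using (hasStrictFDerivAt_exp_zero (𝕂 := ℝ) (𝔸 := V →L[ℝ] V))

end OneParameterGroup

/-! ### Affine vector fields and their flows. -/

/-- Affine vector fields `z ↦ A z + b` on the plane. -/
abbrev AffField : Type := (ℂ →L[ℝ] ℂ) × ℂ

namespace AffField

/-- The value of an affine vector field at a point. -/
def fld (X : AffField) (z : ℂ) : ℂ := X.1 z + X.2

/-- Homogeneous coordinates: an affine vector field as an endomorphism of `ℂ × ℝ`. -/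
def hom : AffField →L[ℝ] (ℂ × ℝ →L[ℝ] ℂ × ℝ) :=
  LinearMap.toContinuousLinearMap
  { toFun := fun X => ((X.1.comp (ContinuousLinearMap.fst ℝ ℂ ℝ)) +
      (ContinuousLinearMap.snd ℝ ℂ ℝ).smulRight X.2).prod 0
    map_add' := by intros; ext <;> simp
    map_smul' := by intros; ext <;> simp }

lemma hom_apply (X : AffField) (w : ℂ × ℝ) : hom X w = (X.1 w.1 + w.2 • X.2, 0) := rfl

/-- The flow of an affine vector field. -/
def flow (X : AffField) (t : ℝ) (z : ℂ) : ℂ := (expGroup (hom X) t (z, (1 : ℝ))).1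

/-- Operators in the range of `hom` have zero `ℝ`-component, so the slice `ℂ × {1}` is invariant. -/
lemma expGroup_hom_apply (X : AffField) (z : ℂ) (t : ℝ) :
    expGroup (hom X) t (z, (1 : ℝ)) = (flow X t z, 1) := by
  have h : ∀ t : ℝ, HasDerivAt (fun t : ℝ => (expGroup (hom X) t (z, (1 : ℝ))).2) 0 t := fun t =>
    (ContinuousLinearMap.snd ℝ ℂ ℝ).hasFDerivAt.comp_hasDerivAt t (hasDerivAt_expGroup (hom X) _ t)
  have := is_const_of_deriv_eq_zero (fun t => (h t).differentiableAt) (fun t => (h t).deriv) t 0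
  simp only [expGroup_zero] at this
  exact Prod.ext rfl this

@[simp] lemma flow_zero (X : AffField) (z : ℂ) : flow X 0 z = z := by
  simp [flow, expGroup_zero]

lemma flow_add (X : AffField) (s t : ℝ) (z : ℂ) :
    flow X (s + t) z = flow X s (flow X t z) := by
  have := expGroup_add_apply (hom X) s t (z, 1)
  rw [expGroup_hom_apply, expGroup_hom_apply, expGroup_hom_apply] at this
  exact (Prod.ext_iff.1 this).1

lemma hasDerivAt_flow (X : AffField) (z : ℂ) (t : ℝ) :
    HasDerivAt (fun t => flow X t z) (fld X (flow X t z)) t := by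
  have h := (ContinuousLinearMap.fst ℝ ℂ ℝ).hasFDerivAt.comp_hasDerivAt t
    (hasDerivAt_expGroup (hom X) (z, 1) t)
  rw [expGroup_hom_apply, hom_apply] at h
  refine h.congr_deriv ?_
  simp [fld]

/-- Uniqueness of solutions; it serves to recognise explicit curves as flow lines. -/
lemma eq_flow_of_hasDerivAt {X : AffField} {c : ℝ → ℂ}
    (hc : ∀ t, HasDerivAt c (fld X (c t)) t) (t : ℝ) : c t = flow X t (c 0) := by
  have h : ∀ t : ℝ, HasDerivAt (fun t : ℝ => expGroup (hom X) (-t) (c t, (1 : ℝ))) 0 t := by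
    intro t
    refine (hasDerivAt_expGroup_neg (hom X)
      ((hc t).prodMk (hasDerivAt_const t (1 : ℝ)))).congr_deriv ?_
    simp [hom_apply, fld]
  have := is_const_of_deriv_eq_zero (fun t => (h t).differentiableAt) (fun t => (h t).deriv) t 0
  have h3 := congrArg (expGroup (hom X) t) this
  rw [← expGroup_add_apply, ← expGroup_add_apply, add_neg_cancel, neg_zero, add_zero,
    expGroup_zero, expGroup_hom_apply] at h3
  exact (Prod.ext_iff.1 h3).1

lemma flow_smul (X : AffField) (c t : ℝ) (z : ℂ) : flow (c • X) t z = flow X (t * c) z := by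
  unfold flow
  rw [map_smul, ← expGroup_smul]

lemma continuous_flow : Continuous fun q : AffField × ℝ × ℂ => flow q.1 q.2.1 q.2.2 := by
  have h1 : Continuous fun q : AffField × ℝ × ℂ => expGroup (hom q.1) q.2.1 :=
    continuous_expGroup.comp ((hom.continuous.comp continuous_fst).prodMk (by fun_prop))
  have h2 : Continuous fun q : AffField × ℝ × ℂ => (q.2.2, (1 : ℝ)) := by fun_prop
  exact continuous_fst.comp (h1.clm_apply h2)

/-! ### Affine bijections: action on fields, and logarithms near the identity. -/

/-- The linear part of an affine bijection of the plane. -/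
def lin (g : ℂ ≃ᵃ[ℝ] ℂ) : ℂ ≃L[ℝ] ℂ := g.linear.toContinuousLinearEquiv

lemma lin_sub (g : ℂ ≃ᵃ[ℝ] ℂ) (z w : ℂ) : lin g (z - w) = g z - g w := by
  exact g.toAffineMap.linearMap_vsub z w

lemma apply_eq_lin_add (g : ℂ ≃ᵃ[ℝ] ℂ) (z : ℂ) : g z = lin g z + g 0 := by
  have := lin_sub g z 0
  rw [sub_zero] at this
  rw [this]; ring

lemma continuous_affine (g : ℂ ≃ᵃ[ℝ] ℂ) : Continuous g := by
  have : (g : ℂ → ℂ) = fun z => lin g z + g 0 := funext (apply_eq_lin_add g)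
  rw [this]; fun_prop

/-- The pull-back of an affine vector field by an affine bijection. -/
def pull (g : ℂ ≃ᵃ[ℝ] ℂ) (X : AffField) : AffField :=
  (((lin g).symm : ℂ →L[ℝ] ℂ) ∘L X.1 ∘L (lin g : ℂ →L[ℝ] ℂ), (lin g).symm (X.1 (g 0) + X.2))

lemma fld_pull (g : ℂ ≃ᵃ[ℝ] ℂ) (X : AffField) (z : ℂ) :
    fld (pull g X) z = (lin g).symm (fld X (g z)) := by
  rw [apply_eq_lin_add g z]
  simp [fld, pull, add_assoc]

lemma continuous_pull (g : ℂ ≃ᵃ[ℝ] ℂ) : Continuous (pull g) := by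
  unfold pull; fun_prop

lemma eq_of_fld_eq {X Y : AffField} (h : ∀ z, fld X z = fld Y z) : X = Y := by
  have h0 : X.2 = Y.2 := by simpa [fld] using h 0
  refine Prod.ext (ContinuousLinearMap.ext fun z => ?_) h0
  have := h z
  simpa [fld, h0] using this

lemma pull_ne_zero (g : ℂ ≃ᵃ[ℝ] ℂ) {X : AffField} (hX : X ≠ 0) : pull g X ≠ 0 := by
  intro h
  apply hX
  apply eq_of_fld_eq
  intro z
  have := fld_pull g X (g.symm z)
  rw [h] at this
  simp only [AffineEquiv.apply_symm_apply] at this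
  have h2 := congrArg (lin g) this
  simpa [fld] using h2.symm

/-- By `fld_pull` the left side solves the equation of `X`. This allows a flow to be viewed in
rescaled coordinates. -/
lemma apply_flow_pull (g : ℂ ≃ᵃ[ℝ] ℂ) (X : AffField) (t : ℝ) (z : ℂ) :
    g (flow (pull g X) t z) = flow X t (g z) := by
  have hc : ∀ t, HasDerivAt (fun t => g (flow (pull g X) t z))
      (fld X (g (flow (pull g X) t z))) t := by
    intro t
    have h1 := ((lin g : ℂ →L[ℝ] ℂ).hasFDerivAt.comp_hasDerivAt t
      (hasDerivAt_flow (pull g X) z t)).add_const (g 0)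
    rw [fld_pull] at h1
    simp only [ContinuousLinearEquiv.coe_coe, ContinuousLinearEquiv.apply_symm_apply] at h1
    exact h1.congr_of_eventuallyEq (Eventually.of_forall fun s => apply_eq_lin_add g _)
  have := eq_flow_of_hasDerivAt hc t
  simpa using this

/-- An affine bijection minus the identity, as an affine vector field. -/
def displacement (f : ℂ ≃ᵃ[ℝ] ℂ) : AffField := ((lin f : ℂ →L[ℝ] ℂ) - ContinuousLinearMap.id ℝ ℂ, f 0)

lemma fld_displacement (f : ℂ ≃ᵃ[ℝ] ℂ) (z : ℂ) : fld (displacement f) z = f z - z := by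
  rw [apply_eq_lin_add f z]; simp [fld, displacement]; ring

/-- An affine field is controlled by its values at `0`, `1` and `I`. -/
lemma tendsto_zero_of_fld {u : ℕ → AffField} (h : ∀ z, Tendsto (fun n => fld (u n) z) atTop (𝓝 0)) :
    Tendsto u atTop (𝓝 0) := by
  have h2 : Tendsto (fun n => (u n).2) atTop (𝓝 0) := by simpa [fld] using h 0
  have h1 : ∀ z, Tendsto (fun n => (u n).1 z) atTop (𝓝 0) := fun z => by
    have := (h z).sub h2
    simpa [fld] using this
  suffices h : Tendsto (fun n => (u n).1) atTop (𝓝 0) from h.prodMk_nhds h2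
  have key : ∀ L : ℂ →L[ℝ] ℂ, ‖L‖ ≤ ‖L 1‖ + ‖L Complex.I‖ := by
    intro L
    refine L.opNorm_le_bound (by positivity) fun z => ?_
    have : z = z.re • (1 : ℂ) + z.im • Complex.I := by simp
    conv_lhs => rw [this, map_add, map_smul, map_smul]
    refine (norm_add_le _ _).trans ?_
    rw [norm_smul, norm_smul, add_mul, mul_comm, mul_comm ‖z.im‖]
    have h1 := Complex.abs_re_le_norm z
    have h2 := Complex.abs_im_le_norm z
    gcongr <;> simpa
  refine squeeze_zero_norm (fun n => key _) ?_
  simpa using (h1 1).norm.add (h1 Complex.I).norm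

/-- The left inverse of `hom`. -/
def hret : (ℂ × ℝ →L[ℝ] ℂ × ℝ) →L[ℝ] AffField :=
  LinearMap.toContinuousLinearMap
  { toFun := fun M => ((ContinuousLinearMap.fst ℝ ℂ ℝ) ∘L M ∘L (ContinuousLinearMap.inl ℝ ℂ ℝ),
      (M (0, 1)).1)
    map_add' := by intros; ext <;> simp
    map_smul' := by intros; ext <;> simp }

lemma hret_apply (M : ℂ × ℝ →L[ℝ] ℂ × ℝ) (z : ℂ) : fld (hret M) z = (M (z, 1)).1 := by
  have : M (z, 1) = M (z, 0) + M (0, 1) := by rw [← map_add]; simp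
  rw [this]; rfl

/-- Affine maps close to the identity are time-one maps of small affine vector fields. -/
lemma exists_log : ∃ lg : AffField → AffField, Tendsto lg (𝓝 0) (𝓝 0) ∧
    ∀ᶠ w in 𝓝 (0 : AffField), ∀ z, flow (lg w) 1 z = z + fld w z := by
  -- The map sending a field to the displacement of its time-one map has derivative the identity at
  -- 0; the logarithm is its local inverse.
  have h0 : HasStrictFDerivAt (fun Y : AffField => hret (expGroup (hom Y) 1 - 1))
      ((ContinuousLinearEquiv.refl ℝ AffField : AffField ≃L[ℝ] AffField) :
        AffField →L[ℝ] AffField) 0 := by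
    have h1 : HasStrictFDerivAt (𝕜 := ℝ) (fun M : ℂ × ℝ →L[ℝ] ℂ × ℝ => expGroup M 1) 1 (hom 0) := by
      rw [map_zero]; exact hasStrictFDerivAt_expGroup_one
    have h2 := hret.hasStrictFDerivAt.comp (0 : AffField)
      ((h1.comp (0 : AffField) hom.hasStrictFDerivAt).sub_const 1)
    refine h2.congr_fderiv ?_
    refine ContinuousLinearMap.ext fun X => eq_of_fld_eq fun z => ?_
    have e : fld (hret (hom X)) z = fld X z := by
      rw [hret_apply]; simp [hom_apply, fld]
    exact e
  have e0 : hret (expGroup (hom 0) 1 - 1) = 0 := by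
    have : expGroup (hom 0) 1 = 1 := by simp [expGroup]
    rw [this, sub_self, map_zero]
  refine ⟨h0.localInverse _ _ _, ?_, ?_⟩
  · have := h0.localInverse_tendsto
    rwa [e0] at this
  · have := h0.eventually_right_inverse
    rw [e0] at this
    filter_upwards [this] with w hw z
    have h3 := hret_apply (expGroup (hom (h0.localInverse _ _ _ w)) 1 - 1) z
    rw [hw] at h3
    rw [h3]
    simp [flow]


/-! ### Flow boxes, uniform in the vector field. -/

/-- Multiplication by a nonzero complex number. -/
def mulEquiv (v : ℂ) (hv : v ≠ 0) : ℂ ≃L[ℝ] ℂ :=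
  ContinuousLinearEquiv.smulLeft (Units.mk0 v hv)

lemma mulEquiv_apply (v : ℂ) (hv : v ≠ 0) (z : ℂ) : mulEquiv v hv z = v * z := rfl

lemma mulEquiv_symm_apply (v : ℂ) (hv : v ≠ 0) (z : ℂ) : (mulEquiv v hv).symm z = z / v := by
  rw [ContinuousLinearEquiv.symm_apply_eq, mulEquiv_apply]
  field_simp

/-- Straightening coordinates for affine vector fields near a given one. -/
def straight (p v : ℂ) (q : AffField × ℂ) : AffField × ℂ :=
  (q.1, flow q.1 q.2.re (p + q.2.im * (Complex.I * v)))

/-- At time 0 the flow does not depend on the field, so the derivative is block diagonal. On `ℂ` it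
sends `1` to `v` (along the flow) and `I` to `I * v` (across it). -/
lemma hasStrictFDerivAt_straight (X₀ : AffField) (p : ℂ) (hv : fld X₀ p ≠ 0) :
    HasStrictFDerivAt (straight p (fld X₀ p))
      (((ContinuousLinearEquiv.refl ℝ AffField).prodCongr (mulEquiv (fld X₀ p) hv) :
        (AffField × ℂ) ≃L[ℝ] (AffField × ℂ)) : AffField × ℂ →L[ℝ] AffField × ℂ) (X₀, 0) := by
  set v := fld X₀ p
  have h1 : HasStrictFDerivAt (𝕜 := ℝ) (fun q : AffField × ℂ => (hom q.1, q.2.re))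
      ((hom ∘L ContinuousLinearMap.fst ℝ AffField ℂ).prod
        (Complex.reCLM ∘L ContinuousLinearMap.snd ℝ AffField ℂ)) (X₀, 0) :=
    ((hom ∘L ContinuousLinearMap.fst ℝ AffField ℂ).prod
        (Complex.reCLM ∘L ContinuousLinearMap.snd ℝ AffField ℂ)).hasStrictFDerivAt
  have h2 := HasStrictFDerivAt.comp (f := fun q : AffField × ℂ => (hom q.1, q.2.re)) (X₀, (0 : ℂ))
    (hasStrictFDerivAt_expGroup_zero (hom X₀)) h1
  have h3 : HasStrictFDerivAt (𝕜 := ℝ)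
      (fun q : AffField × ℂ => (p + q.2.im • (Complex.I * v), (1 : ℝ)))
      (((Complex.imCLM ∘L ContinuousLinearMap.snd ℝ AffField ℂ).smulRight (Complex.I * v)).prod 0)
      (X₀, 0) :=
    HasStrictFDerivAt.prodMk
      ((((Complex.imCLM ∘L ContinuousLinearMap.snd ℝ AffField ℂ).smulRight
        (Complex.I * v)).hasStrictFDerivAt).const_add p) (hasStrictFDerivAt_const _ _)
  have h4 := (ContinuousLinearMap.fst ℝ ℂ ℝ).hasStrictFDerivAt.comp (X₀, (0 : ℂ)) (h2.clm_apply h3)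
  have h5 := (hasStrictFDerivAt_fst (𝕜 := ℝ) (p := (X₀, (0 : ℂ)))).prodMk h4
  have e : straight p v = fun q : AffField × ℂ => (q.1, (ContinuousLinearMap.fst ℝ ℂ ℝ)
      ((expGroup (hom q.1) q.2.re) (p + q.2.im • (Complex.I * v), (1 : ℝ)))) := by
    funext q; simp [straight, flow]
  rw [e]
  refine h5.congr_fderiv ?_
  refine ContinuousLinearMap.ext fun q => Prod.ext rfl ?_
  have e2 : expGroup (hom X₀) 0 = 1 := expGroup_zero _
  have key : (q.2.im : ℂ) * (Complex.I * v) + q.2.re * v = v * q.2 := by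
    conv_rhs => rw [← Complex.re_add_im q.2]
    ring
  have hv' : X₀.1 p + X₀.2 = v := rfl
  simpa [e2, hom_apply, mulEquiv_apply, ← mul_add, hv'] using key

lemma norm_mk_sub_mk (X : AffField) (z w : ℂ) : ‖((X, z) - (X, w) : AffField × ℂ)‖ = ‖z - w‖ := by
  rw [Prod.mk_sub_mk, sub_self, Prod.norm_def, norm_zero, max_eq_right (norm_nonneg _)]

/-- `ζ` is a straightening coordinate on the ball of radius `ρ` around `p`, for all affine vector
fields in the ball of radius `ρ` around `X₀`. -/
structure IsFlowBox (X₀ : AffField) (p : ℂ) (ρ R : ℝ) (ζ : AffField → ℂ → ℂ) : Prop where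
  continuousOn : ContinuousOn (fun q : AffField × ℂ => ζ q.1 q.2) (ball X₀ ρ ×ˢ ball p ρ)
  shift : ∀ X ∈ ball X₀ ρ, ∀ z ∈ ball p ρ, ∀ t : ℝ, |t| < ρ → ζ X (flow X t z) = ζ X z + t
  im_lt : ∀ X ∈ ball X₀ ρ, ∀ z ∈ ball p ρ, ∀ w ∈ ball p ρ, ∀ r : ℝ, 0 < r →
    z = w + r * (Complex.I * fld X₀ p) → (ζ X w).im < (ζ X z).im
  re_pos : ∀ X ∈ ball X₀ ρ, ∀ z ∈ ball p ρ, ∀ t : ℝ, 0 < t → t < ρ →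
    0 < ((flow X t z - z) / fld X₀ p).re
  norm_lt : ∀ X ∈ ball X₀ ρ, ∀ z ∈ ball p ρ, ‖ζ X z‖ < R
  eq_flow : ∀ X ∈ ball X₀ ρ, ∀ z ∈ ball p ρ,
    z = flow X (ζ X z).re (p + (ζ X z).im * (Complex.I * fld X₀ p))
  injOn : ∀ X ∈ ball X₀ ρ, ∀ y : ℝ, |y| < R →
    InjOn (fun t => flow X t (p + y * (Complex.I * fld X₀ p))) (Icc (-R) R)

/-- Flow box theorem, uniform in the vector field. -/
lemma exists_isFlowBox (X₀ : AffField) (p : ℂ) (hv : fld X₀ p ≠ 0) :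
    ∃ ρ > 0, ∃ R > 0, ∃ ζ : AffField → ℂ → ℂ, IsFlowBox X₀ p ρ R ζ := by
  have hf := hasStrictFDerivAt_straight X₀ p hv
  set v := fld X₀ p
  have hp : straight p v (X₀, 0) = (X₀, p) := by simp [straight]
  set li := hf.localInverse _ _ _ with hli
  have ev1 : ∀ᶠ q in 𝓝 (X₀, (0 : ℂ)), li (straight p v q) = q := hf.eventually_left_inverse
  have ev2 : ∀ᶠ y in 𝓝 (X₀, p), straight p v (li y) = y := by
    have := hf.eventually_right_inverse
    rwa [hp] at this
  have li0 : Tendsto li (𝓝 (X₀, p)) (𝓝 (X₀, 0)) := by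
    have := hf.localInverse_tendsto
    rwa [hp] at this
  have hvpos : 0 < ‖v‖ := norm_pos_iff.2 hv
  -- The constants are half of `‖v‖` here and half of `1 / ‖v‖` for the inverse, so that the linear
  -- term decides the signs in `re_pos` and `im_lt`.
  obtain ⟨s3, hs3, ap3⟩ := hf.approximates_deriv_on_nhds (c := ‖v‖₊ / 2)
    (Or.inr (half_pos (nnnorm_pos.2 hv)))
  have hg : HasStrictFDerivAt li _ (X₀, p) := hp ▸ hf.to_localInverse
  obtain ⟨s4, hs4, ap4⟩ := hg.approximates_deriv_on_nhds (c := 1 / (2 * ‖v‖₊))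
    (Or.inr (by have := nnnorm_pos.2 hv; positivity))
  obtain ⟨R', hR', hball⟩ := Metric.eventually_nhds_iff_ball.1 (ev1.and hs3)
  -- The coordinate and the time shift are both bounded by `R`, so their sum stays in the ball of
  -- radius `R'` where `li` inverts `straight`.
  set R := R' / 2 with hRdef
  have hR : 0 < R := by positivity
  have ev5 : ∀ᶠ y in 𝓝 (X₀, p), li y ∈ ball (X₀, (0 : ℂ)) R := li0 (ball_mem_nhds _ hR)
  obtain ⟨ρ', hρ', hball'⟩ := Metric.eventually_nhds_iff_ball.1 ((ev2.and hs4).and ev5)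
  have memB : ∀ X ∈ ball X₀ (min ρ' R), ∀ z ∈ ball p (min ρ' R), (X, z) ∈ ball (X₀, p) ρ' := by
    intro X hX z hz
    rw [mem_ball, Prod.dist_eq, max_lt_iff]
    exact ⟨(mem_ball.1 hX).trans_le (min_le_left _ _), (mem_ball.1 hz).trans_le (min_le_left _ _)⟩
  have memA : ∀ X ∈ ball X₀ (min ρ' R), ∀ z : ℂ, ‖z‖ < R' → (X, z) ∈ ball (X₀, (0 : ℂ)) R' := by
    intro X hX z hz
    rw [mem_ball, Prod.dist_eq, max_lt_iff]
    refine ⟨(mem_ball.1 hX).trans_le ((min_le_right _ _).trans (half_le_self hR'.le)), ?_⟩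
    simpa using hz
  have hfst : ∀ X ∈ ball X₀ (min ρ' R), ∀ z ∈ ball p (min ρ' R), li (X, z) = (X, (li (X, z)).2) := by
    intro X hX z hz
    have := (hball' _ (memB X hX z hz)).1.1
    have h1 : (li (X, z)).1 = X := congrArg Prod.fst this
    exact Prod.ext h1 rfl
  have hsnd : ∀ X ∈ ball X₀ (min ρ' R), ∀ z ∈ ball p (min ρ' R), ‖(li (X, z)).2‖ < R := by
    intro X hX z hz
    have := (hball' _ (memB X hX z hz)).2
    rw [mem_ball, Prod.dist_eq, max_lt_iff] at this
    simpa using this.2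
  have hz_eq : ∀ X ∈ ball X₀ (min ρ' R), ∀ z ∈ ball p (min ρ' R),
      z = flow X (li (X, z)).2.re (p + (li (X, z)).2.im * (Complex.I * v)) := by
    intro X hX z hz
    have := (hball' _ (memB X hX z hz)).1.1
    rw [hfst X hX z hz] at this
    exact (congrArg Prod.snd this).symm
  have hshift : ∀ X ∈ ball X₀ (min ρ' R), ∀ z ∈ ball p (min ρ' R), ∀ t : ℝ,
      straight p v (X, (li (X, z)).2 + t) = (X, flow X t z) := by
    intro X hX z hz t
    refine Prod.ext rfl ?_
    simp only [straight, Complex.add_re, Complex.ofReal_re, Complex.add_im, Complex.ofReal_im,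
      add_zero]
    rw [add_comm, flow_add, ← hz_eq X hX z hz]
  refine ⟨min ρ' R, lt_min hρ' hR, R, hR, fun X z => (li (X, z)).2, ⟨?_, ?_, ?_, ?_, ?_, ?_, ?_⟩⟩
  · refine continuous_snd.comp_continuousOn (ap4.continuousOn.mono ?_)
    rintro ⟨X, z⟩ ⟨hX, hz⟩
    exact (hball' _ (memB X hX z hz)).1.2
  · intro X hX z hz t ht
    have h1 : ‖(li (X, z)).2 + t‖ < R' := by
      refine (norm_add_le _ _).trans_lt ?_
      have := hsnd X hX z hz
      have h2 : ‖(t : ℂ)‖ < R := by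
        rw [Complex.norm_real]; exact ht.trans_le (min_le_right _ _)
      have : R' = R + R := by rw [hRdef]; ring
      linarith
    have := (hball _ (memA X hX _ h1)).1
    rw [hshift X hX z hz] at this
    exact congrArg Prod.snd this
  · intro X hX z hz w hw r hr hzw
    have h1 := ap4 _ (hball' _ (memB X hX z hz)).1.2 _ (hball' _ (memB X hX w hw)).1.2
    have h2 : z - w = r * (Complex.I * v) := by rw [hzw]; ring
    have h3 : ‖(li (X, z)).2 - (li (X, w)).2 - (mulEquiv v hv).symm (z - w)‖ ≤
        1 / (2 * ‖v‖) * ‖((X, z) - (X, w) : AffField × ℂ)‖ := (norm_snd_le _).trans h1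
    have h4 : (mulEquiv v hv).symm (z - w) = r * Complex.I := by
      rw [mulEquiv_symm_apply, h2]
      field_simp
    rw [norm_mk_sub_mk, h4, h2] at h3
    have h5 : ‖(r : ℂ) * (Complex.I * v)‖ = r * ‖v‖ := by
      simp [abs_of_pos hr]
    rw [h5] at h3
    have h6 : (1 / (2 * ‖v‖)) * (r * ‖v‖) = r / 2 := by field_simp
    have h7 : ‖(li (X, z)).2 - (li (X, w)).2 - r * Complex.I‖ ≤ r / 2 := h6 ▸ h3
    have h8 := (Complex.abs_im_le_norm _).trans h7
    simp only [Complex.sub_im, Complex.mul_im, Complex.ofReal_re, Complex.I_im, mul_one,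
      Complex.ofReal_im, Complex.I_re, mul_zero, add_zero] at h8
    have := (abs_le.1 h8).1
    linarith
  · intro X hX z hz t ht0 ht
    have h0 : ‖(li (X, z)).2‖ < R' := (hsnd X hX z hz).trans (half_lt_self hR')
    have h1 : ‖(li (X, z)).2 + t‖ < R' := by
      refine (norm_add_le _ _).trans_lt ?_
      have := hsnd X hX z hz
      have h2 : ‖(t : ℂ)‖ < R := by
        rw [Complex.norm_real, Real.norm_eq_abs, abs_of_pos ht0]
        exact ht.trans_le (min_le_right _ _)
      have : R' = R + R := by rw [hRdef]; ring
      linarith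
    have h3 := ap3 _ (hball _ (memA X hX _ h1)).2 _ (hball _ (memA X hX _ h0)).2
    have e0 := hshift X hX z hz 0
    simp only [Complex.ofReal_zero, add_zero, flow_zero] at e0
    rw [hshift X hX z hz, e0, norm_mk_sub_mk, add_sub_cancel_left] at h3
    have h4 : ‖flow X t z - z - v * ((li (X, z)).2 + t - (li (X, z)).2)‖ ≤ ‖v‖ / 2 * ‖(t : ℂ)‖ :=
      (norm_snd_le _).trans h3
    have h5 : ‖flow X t z - z - v * t‖ ≤ ‖v‖ / 2 * t := by
      have : ‖(t : ℂ)‖ = t := by simp [abs_of_pos ht0]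
      rwa [this, add_sub_cancel_left] at h4
    have h6 : ‖(flow X t z - z) / v - t‖ ≤ t / 2 := by
      have : (flow X t z - z) / v - t = (flow X t z - z - v * t) / v := by field_simp
      rw [this, norm_div, div_le_iff₀ hvpos]
      linarith
    have h7 := (Complex.abs_re_le_norm _).trans h6
    rw [Complex.sub_re, Complex.ofReal_re] at h7
    have := (abs_le.1 h7).1
    linarith
  · intro X hX z hz
    exact hsnd X hX z hz
  · intro X hX z hz
    exact hz_eq X hX z hz
  · intro X hX y hy t ht t' ht' htt
    have key : ∀ t ∈ Icc (-R) R, li (X, flow X t (p + y * (Complex.I * v))) = (X, t + y * Complex.I) := by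
      intro t ht
      have h1 : ‖(t : ℂ) + y * Complex.I‖ < R' := by
        refine (norm_add_le _ _).trans_lt ?_
        have h2 : ‖(t : ℂ)‖ ≤ R := by
          rw [Complex.norm_real]; exact abs_le.2 ht
        have h3 : ‖(y : ℂ) * Complex.I‖ < R := by simpa using hy
        have : R' = R + R := by rw [hRdef]; ring
        linarith
      have := (hball _ (memA X hX _ h1)).1
      simpa [straight] using this
    have h := congrArg (fun z => li (X, z)) htt
    simp only [] at h
    rw [key t ht, key t' ht'] at h
    have h2 := congrArg (fun q => Complex.re (Prod.snd q)) h
    simpa using h2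

end AffField

/-! ### Continuous logarithms and arguments. -/

/-- A nonvanishing continuous function on a compact convex set has a continuous logarithm. -/
lemma exists_continuousOn_log {E : Type*} [NormedAddCommGroup E] [NormedSpace ℝ E] {K : Set E}
    (hK : IsCompact K) (hc : Convex ℝ K) {F : E → ℂ} (hF : ContinuousOn F K)
    (h0 : ∀ x ∈ K, F x ≠ 0) :
    ∃ Λ : E → ℂ, ContinuousOn Λ K ∧ ∀ x ∈ K, Complex.exp (Λ x) = F x := by
  rcases K.eq_empty_or_nonempty with rfl | ⟨c, hcK⟩
  · exact ⟨0, by simp, by simp⟩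
  obtain ⟨x₀, hx₀, hmin⟩ := hK.exists_isMinOn ⟨c, hcK⟩ hF.norm
  have hm : 0 < ‖F x₀‖ := norm_pos_iff.2 (h0 _ hx₀)
  obtain ⟨δ, hδ, hδF⟩ := Metric.uniformContinuousOn_iff.1 (hK.uniformContinuousOn_of_continuous hF)
    _ hm
  obtain ⟨D, hD⟩ := hK.isBounded.subset_closedBall c
  obtain ⟨N, hN⟩ := exists_nat_gt (max D 0 / δ)
  have hN0 : (0 : ℝ) < N := lt_of_le_of_lt (by positivity) hN
  have hmem : ∀ x ∈ K, ∀ k : ℕ, k ≤ N → AffineMap.lineMap c x ((k : ℝ) / N) ∈ K := by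
    intro x hx k hk
    refine hc.lineMap_mem hcK hx ⟨by positivity, ?_⟩
    rw [div_le_one hN0]
    exact_mod_cast hk
  have hratio : ∀ x ∈ K, ∀ k ∈ Finset.range N,
      F (AffineMap.lineMap c x (((k + 1 : ℕ) : ℝ) / N)) / F (AffineMap.lineMap c x ((k : ℝ) / N)) ∈
        Complex.slitPlane := by
    intro x hx k hk
    have hk := Finset.mem_range.1 hk
    have m1 := hmem x hx (k + 1) hk
    have m0 := hmem x hx k hk.le
    have hd : dist (AffineMap.lineMap c x (((k + 1 : ℕ) : ℝ) / N) : E)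
        (AffineMap.lineMap c x ((k : ℝ) / N)) < δ := by
      rw [dist_lineMap_lineMap]
      have h1 : dist (((k + 1 : ℕ) : ℝ) / N) ((k : ℝ) / N) = 1 / N := by
        rw [Real.dist_eq, ← sub_div, abs_div, abs_of_pos hN0]
        push_cast
        simp
      rw [h1, one_div_mul_eq_div, div_lt_iff₀ hN0]
      have h2 : dist c x ≤ max D 0 := by
        rw [dist_comm]; exact (hD hx).trans (le_max_left _ _)
      rw [div_lt_iff₀ hδ] at hN
      linarith
    have h3 := hδF _ m1 _ m0 hd
    have hne := h0 _ m0
    have h4 : ‖F x₀‖ ≤ ‖F (AffineMap.lineMap c x ((k : ℝ) / N))‖ := hmin m0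
    have := Complex.mem_slitPlane_of_norm_lt_one
      (z := (F (AffineMap.lineMap c x (((k + 1 : ℕ) : ℝ) / N)) -
        F (AffineMap.lineMap c x ((k : ℝ) / N))) / F (AffineMap.lineMap c x ((k : ℝ) / N))) (by
        rw [norm_div, div_lt_one (norm_pos_iff.2 hne), ← dist_eq_norm]
        exact h3.trans_le h4)
    convert this using 1
    field_simp
    ring
  have hcont : ∀ k : ℕ, k ≤ N → ContinuousOn (fun x => F (AffineMap.lineMap c x ((k : ℝ) / N))) K := by
    intro k hk
    refine hF.comp (Continuous.continuousOn ?_) (fun x hx => hmem x hx k hk)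
    simp only [AffineMap.lineMap_apply, vsub_eq_sub, vadd_eq_add]
    fun_prop
  -- Telescoping along `N` equal steps from `c` to `x`: each ratio is within distance 1 of 1, where
  -- the principal logarithm is continuous.
  refine ⟨fun x => Complex.log (F c) + ∑ k ∈ Finset.range N,
    Complex.log (F (AffineMap.lineMap c x (((k + 1 : ℕ) : ℝ) / N)) /
      F (AffineMap.lineMap c x ((k : ℝ) / N))), ?_, ?_⟩
  · refine continuousOn_const.add (continuousOn_finsetSum _ fun k hk => ?_)
    refine ContinuousOn.clog ?_ (fun x hx => hratio x hx k hk)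
    have hk := Finset.mem_range.1 hk
    exact (hcont (k + 1) hk).div (hcont k hk.le) fun x hx => h0 _ (hmem x hx k hk.le)
  · intro x hx
    rw [Complex.exp_add, Complex.exp_log (h0 c hcK), Complex.exp_sum]
    have : ∀ k ∈ Finset.range N, Complex.exp (Complex.log
        (F (AffineMap.lineMap c x (((k + 1 : ℕ) : ℝ) / N)) / F (AffineMap.lineMap c x ((k : ℝ) / N)))) =
        F (AffineMap.lineMap c x (((k + 1 : ℕ) : ℝ) / N)) / F (AffineMap.lineMap c x ((k : ℝ) / N)) :=
      fun k hk => Complex.exp_log (Complex.slitPlane_ne_zero (hratio x hx k hk))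
    rw [Finset.prod_congr rfl this]
    have hp : ∀ M : ℕ, M ≤ N → F c * ∏ k ∈ Finset.range M,
        F (AffineMap.lineMap c x (((k + 1 : ℕ) : ℝ) / N)) / F (AffineMap.lineMap c x ((k : ℝ) / N)) =
        F (AffineMap.lineMap c x ((M : ℝ) / N)) := by
      intro M
      induction M with
      | zero => intro _; simp
      | succ M ih =>
        intro hM
        rw [Finset.prod_range_succ, ← mul_assoc, ih (by omega)]
        field_simp [h0 _ (hmem x hx M (by omega))]
    rw [hp N le_rfl, div_self hN0.ne']
    simp

/-- A continuous function with constant exponential has constant imaginary part. -/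
lemma im_eq_of_exp_eq {f : ℝ → ℂ} {a b : ℝ} (hf : ContinuousOn f (uIcc a b))
    (h : ∀ r ∈ uIcc a b, Complex.exp (f r) = Complex.exp (f a)) : (f b).im = (f a).im := by
  have hval : ∀ r ∈ uIcc a b, ∃ n : ℤ, (f r).im - (f a).im = n * (2 * Real.pi) := by
    intro r hr
    obtain ⟨n, hn⟩ := Complex.exp_eq_exp_iff_exists_int.1 (h r hr)
    refine ⟨n, ?_⟩
    rw [hn]; simp
  have him : ContinuousOn (fun r => (f r).im) (uIcc a b) := Complex.continuous_im.comp_continuousOn hf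
  by_contra hne
  obtain ⟨n, hn⟩ := hval b right_mem_uIcc
  have hpi := Real.pi_pos
  have hn0 : n ≠ 0 := by
    rintro rfl; apply hne; simp at hn; linarith
  -- A nonzero jump would take the difference through an odd multiple of `π`, but it only takes even
  -- ones.
  have hmid : ∃ y ∈ uIcc (f a).im (f b).im, ∃ k : ℤ, y - (f a).im = (2 * k + 1) * Real.pi := by
    rcases lt_or_gt_of_ne hn0 with h0 | h0
    · refine ⟨(f a).im - Real.pi, ?_, -1, by push_cast; ring⟩
      have : (n : ℝ) ≤ -1 := by exact_mod_cast Int.le_sub_one_of_lt h0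
      rw [mem_uIcc]; right
      constructor <;> nlinarith
    · refine ⟨(f a).im + Real.pi, ?_, 0, by push_cast; ring⟩
      have : (1 : ℝ) ≤ n := by exact_mod_cast h0
      rw [mem_uIcc]; left
      constructor <;> nlinarith
  obtain ⟨y, hy, k, hk⟩ := hmid
  obtain ⟨r, hr, rfl⟩ := intermediate_value_uIcc him hy
  obtain ⟨l, hl⟩ := hval r hr
  have h2 : ((2 * k + 1 : ℤ) : ℝ) = ((2 * l : ℤ) : ℝ) := by
    have : ((2 * k + 1 : ℝ)) * Real.pi = (2 * l) * Real.pi := by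
      simp only [] at hk
      rw [← hk, hl]; ring
    have := mul_right_cancel₀ hpi.ne' this
    push_cast; exact this
  have h3 : 2 * k + 1 = 2 * l := by exact_mod_cast h2
  omega

/-- If the argument jumps by at least `π` from `a` to `b`, the segment from `a` to `b` meets the
closed negative real axis. -/
lemma exists_convex_comb_nonpos {a b : ℂ} (hb : b ∈ Complex.slitPlane)
    (h : Complex.arg a + Real.pi ≤ Complex.arg b) :
    ∃ t ∈ Icc (0 : ℝ) 1, ((1 - t) * a + t * b : ℂ).im = 0 ∧ ((1 - t) * a + t * b : ℂ).re ≤ 0 := by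
  have hpi := Real.pi_pos
  have hb1 : Complex.arg b < Real.pi :=
    lt_of_le_of_ne (Complex.arg_le_pi b) (Complex.mem_slitPlane_iff_arg.1 hb).1
  have ha1 := Complex.neg_pi_lt_arg a
  have hia : a.im < 0 := Complex.arg_neg_iff.1 (by linarith)
  have hib : 0 < b.im := by
    have h1 : 0 ≤ b.im := Complex.arg_nonneg_iff.1 (by linarith)
    refine lt_of_le_of_ne h1 fun h2 => ?_
    have h3 : 0 < b.re := by
      rcases Complex.mem_slitPlane_iff.1 hb with h4 | h4
      · exact h4
      · exact absurd h2.symm h4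
    have : Complex.arg b = 0 := Complex.arg_eq_zero_iff.2 ⟨h3.le, h2.symm⟩
    linarith
  have hsin : Real.sin (Complex.arg b - Complex.arg a) ≤ 0 := by
    have := Real.sin_nonneg_of_nonneg_of_le_pi (x := Complex.arg b - Complex.arg a - Real.pi)
      (by linarith) (by linarith)
    rw [Real.sin_sub_pi] at this
    linarith
  have hdet : a.re * b.im - a.im * b.re ≤ 0 := by
    rw [Real.sin_sub] at hsin
    rw [← Complex.norm_mul_cos_arg a, ← Complex.norm_mul_sin_arg a, ← Complex.norm_mul_cos_arg b,
      ← Complex.norm_mul_sin_arg b]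
    have : 0 ≤ ‖a‖ * ‖b‖ := by positivity
    nlinarith
  have hd : 0 < b.im - a.im := by linarith
  -- This is where the segment crosses the real axis; the real part there has the sign of `hdet`,
  -- that is, of the sine of the difference of arguments.
  refine ⟨-a.im / (b.im - a.im), ⟨by apply div_nonneg <;> linarith, ?_⟩, ?_, ?_⟩
  · rw [div_le_one hd]; linarith
  · simp only [Complex.add_im, Complex.mul_im, Complex.sub_re, Complex.one_re, Complex.ofReal_re,
      Complex.sub_im, Complex.one_im, Complex.ofReal_im]
    field_simp
    ring
  · simp only [Complex.add_re, Complex.mul_re, Complex.sub_re, Complex.one_re, Complex.ofReal_re,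
      Complex.sub_im, Complex.one_im, Complex.ofReal_im]
    have : (1 - -a.im / (b.im - a.im)) * a.re - (0 - 0) * a.im +
      (-a.im / (b.im - a.im) * b.re - 0 * b.im) = (a.re * b.im - a.im * b.re) / (b.im - a.im) := by
      field_simp; ring
    rw [this]
    exact div_nonpos_of_nonpos_of_nonneg hdet hd.le

lemma arg_neg_I_mul_sub_arg_I_mul {w : ℂ} (hw : 0 < w.re) :
    Complex.arg (-Complex.I * w) - Complex.arg (Complex.I * w) = -Real.pi := by
  have hpi := Real.pi_pos
  have h0 : w ≠ 0 := by rintro rfl; simp at hw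
  have h1 : |Complex.arg w| < Real.pi / 2 := Complex.abs_arg_lt_pi_div_two_iff.2 (Or.inl hw)
  rw [abs_lt] at h1
  rw [Complex.arg_mul (by simp) h0 (by rw [Complex.arg_neg_I]; constructor <;> linarith),
    Complex.arg_mul (by simp) h0 (by rw [Complex.arg_I]; constructor <;> linarith),
    Complex.arg_I, Complex.arg_neg_I]
  ring

/-! ### Arcs moved off themselves by small flow maps. -/

/-- The change of argument of `g (ψ s) - ψ t` across the diagonal is governed by the growth of an
invariant function `u` along `ψ`. -/
lemma im_log_sub_pos {ψ : ℝ → ℂ} {g : ℂ → ℂ} {Λ : ℝ × ℝ → ℂ} {v : ℂ} {u : ℂ → ℝ} {B : Set ℂ}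
    {a b : ℝ} (hv : v ≠ 0) (hΛc : ContinuousOn Λ (uIcc a b ×ˢ uIcc a b))
    (hΛ : ∀ s ∈ uIcc a b, ∀ t ∈ uIcc a b, Complex.exp (Λ (s, t)) = g (ψ s) - ψ t)
    (hψ : ContinuousOn ψ (uIcc a b)) (hg : Continuous g)
    (hB : ∀ r ∈ uIcc a b, ψ r ∈ B) (hgB : ∀ r ∈ uIcc a b, g (ψ r) ∈ B) (hBc : Convex ℝ B)
    (hinv : ∀ r ∈ uIcc a b, u (g (ψ r)) = u (ψ r)) (hmin : ∀ r ∈ uIcc a b, u (ψ a) ≤ u (ψ r))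
    (hu : ∀ z ∈ B, ∀ w ∈ B, ∀ r : ℝ, 0 < r → z = w + r * (Complex.I * v) → u w < u z)
    (hre : 0 < ((g (ψ a) - ψ a) / v).re)
    (hlt : ∀ t ∈ Icc (0 : ℝ) 1,
      u ((1 - t) * ψ a + t * g (ψ a)) < u ((1 - t) * g (ψ b) + t * ψ b)) :
    0 < (Λ (b, a)).im - (Λ (a, b)).im := by
  have hpi := Real.pi_pos
  have haI : a ∈ uIcc a b := left_mem_uIcc
  have hbI : b ∈ uIcc a b := right_mem_uIcc
  have hne : ∀ s ∈ uIcc a b, ∀ t ∈ uIcc a b, g (ψ s) - ψ t ≠ 0 := fun s hs t ht => by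
    rw [← hΛ s hs t ht]; exact Complex.exp_ne_zero _
  -- Regard `I * v` as "up" and `u` as height. As `g` preserves height and `ψ a` is lowest, `g (ψ
  -- a)` is never straight above `ψ r`; the rotation puts the excluded ray on the negative axis.
  have hP : ∀ r ∈ uIcc a b, Complex.I * ((g (ψ a) - ψ r) / v) ∈ Complex.slitPlane := by
    intro r hr
    by_contra hcon
    rw [Complex.mem_slitPlane_iff, not_or, not_lt, not_not] at hcon
    set l := (Complex.I * ((g (ψ a) - ψ r) / v)).re with hl
    have e : Complex.I * ((g (ψ a) - ψ r) / v) = l := by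
      exact Complex.ext (by rw [Complex.ofReal_re]) (by rw [Complex.ofReal_im]; exact hcon.2)
    have e2 : g (ψ a) - ψ r = (-l : ℝ) * (Complex.I * v) := by
      have : g (ψ a) - ψ r = -(Complex.I * (Complex.I * ((g (ψ a) - ψ r) / v)) * v) := by
        field_simp; simp
      rw [this, e]; push_cast; ring
    have hl0 : l ≠ 0 := by
      intro h; rw [h] at e2; apply hne a haI r hr; simpa using e2
    have h3 := hu _ (hgB a haI) _ (hB r hr) (-l) (by
      have := hcon.1; rcases this.lt_or_eq with h | h
      · linarith
      · exact absurd h hl0) (by rw [← e2]; ring)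
    rw [hinv a haI] at h3
    exact absurd (hmin r hr) (not_le.2 h3)
  -- Likewise `g (ψ r)` is never straight below `ψ a`, whence the opposite rotation.
  have hQ : ∀ r ∈ uIcc a b, -Complex.I * ((g (ψ r) - ψ a) / v) ∈ Complex.slitPlane := by
    intro r hr
    by_contra hcon
    rw [Complex.mem_slitPlane_iff, not_or, not_lt, not_not] at hcon
    set l := (-Complex.I * ((g (ψ r) - ψ a) / v)).re with hl
    have e : -Complex.I * ((g (ψ r) - ψ a) / v) = l := by
      exact Complex.ext (by rw [Complex.ofReal_re]) (by rw [Complex.ofReal_im]; exact hcon.2)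
    have e2 : g (ψ r) - ψ a = (l : ℝ) * (Complex.I * v) := by
      have : g (ψ r) - ψ a = (Complex.I * (-Complex.I * ((g (ψ r) - ψ a) / v)) * v) := by
        field_simp; simp
      rw [this, e]; ring
    have hl0 : l ≠ 0 := by
      intro h; rw [h] at e2; apply hne r hr a haI; simpa using e2
    have h3 := hu _ (hB a haI) _ (hgB r hr) (-l) (by
      have := hcon.1; rcases this.lt_or_eq with h | h
      · linarith
      · exact absurd h hl0) (by
        have : ψ a = g (ψ r) - (g (ψ r) - ψ a) := by ring
        rw [this, e2]; push_cast; ring)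
    rw [hinv r hr] at h3
    exact absurd (hmin r hr) (not_le.2 h3)
  have hgψ : ContinuousOn (fun r => g (ψ r)) (uIcc a b) := hg.comp_continuousOn hψ
  -- The continuous argument and the rotated principal argument differ by a constant along the edge
  -- from `(a, a)`, so principal arguments compute the change of `Λ`.
  have k1 : (Λ (a, b)).im - Complex.arg (Complex.I * ((g (ψ a) - ψ b) / v)) =
      (Λ (a, a)).im - Complex.arg (Complex.I * ((g (ψ a) - ψ a) / v)) := by
    have := im_eq_of_exp_eq (a := a) (b := b)
      (f := fun r => Λ (a, r) - Complex.log (Complex.I * ((g (ψ a) - ψ r) / v))) (by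
        refine ContinuousOn.sub (hΛc.comp (by fun_prop) fun r hr => ⟨haI, hr⟩) (ContinuousOn.clog ?_ hP)
        fun_prop) (by
        intro r hr
        rw [Complex.exp_sub, Complex.exp_sub, hΛ a haI r hr, hΛ a haI a haI,
          Complex.exp_log (Complex.slitPlane_ne_zero (hP r hr)),
          Complex.exp_log (Complex.slitPlane_ne_zero (hP a haI))]
        have h1 := hne a haI r hr
        have h2 := hne a haI a haI
        field_simp)
    simpa [Complex.log_im] using this
  have k2 : (Λ (b, a)).im - Complex.arg (-Complex.I * ((g (ψ b) - ψ a) / v)) =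
      (Λ (a, a)).im - Complex.arg (-Complex.I * ((g (ψ a) - ψ a) / v)) := by
    have := im_eq_of_exp_eq (a := a) (b := b)
      (f := fun r => Λ (r, a) - Complex.log (-Complex.I * ((g (ψ r) - ψ a) / v))) (by
        refine ContinuousOn.sub (hΛc.comp (by fun_prop) fun r hr => ⟨hr, haI⟩) (ContinuousOn.clog ?_ hQ)
        fun_prop) (by
        intro r hr
        rw [Complex.exp_sub, Complex.exp_sub, hΛ r hr a haI, hΛ a haI a haI,
          Complex.exp_log (Complex.slitPlane_ne_zero (hQ r hr)),
          Complex.exp_log (Complex.slitPlane_ne_zero (hQ a haI))]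
        have h1 := hne r hr a haI
        have h2 := hne a haI a haI
        field_simp)
    simpa [Complex.log_im] using this
  have k3 := arg_neg_I_mul_sub_arg_I_mul hre
  -- If the claim failed, the two principal arguments at `b` would differ by at least `π`, and some
  -- point of the segment from `ψ a` to `g (ψ a)` would equal or lie straight above a point of the
  -- one from `g (ψ b)` to `ψ b`, against `hlt`.
  by_contra hcon
  obtain ⟨t, ht, him, hre'⟩ := exists_convex_comb_nonpos
    (a := -Complex.I * ((g (ψ b) - ψ a) / v)) (hP b hbI) (by linarith)
  set c := ((1 - t) * (-Complex.I * ((g (ψ b) - ψ a) / v)) +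
    t * (Complex.I * ((g (ψ a) - ψ b) / v)) : ℂ) with hcdef
  have hcre : c = c.re := Complex.ext rfl (by simpa using him)
  have e3 : ((1 - t) * ψ a + t * g (ψ a) : ℂ) =
      ((1 - t) * g (ψ b) + t * ψ b) + ((-c.re : ℝ) : ℂ) * (Complex.I * v) := by
    have h1 : c * (Complex.I * v) = ((1 - t) * g (ψ b) + t * ψ b) - ((1 - t) * ψ a + t * g (ψ a)) := by
      rw [hcdef]; field_simp; ring_nf; simp; ring
    rw [Complex.ofReal_neg, ← hcre, neg_mul, h1]; ring
  have hcomb : ∀ x ∈ B, ∀ y ∈ B, ((1 - t) * x + t * y : ℂ) ∈ B := by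
    intro x hx y hy
    have := hBc hx hy (a := 1 - t) (b := t) (by linarith [ht.2]) ht.1 (by ring)
    simpa using this
  have h5 := hlt t ht
  rcases hre'.lt_or_eq with h | h
  · have := hu _ (hcomb _ (hB a haI) _ (hgB a haI)) _ (hcomb _ (hgB b hbI) _ (hB b hbI)) (-c.re)
      (by linarith) e3
    linarith
  · rw [e3, h] at h5
    simp at h5

namespace AffField

lemma eventually_norm_flow_sub_lt {Xm : ℕ → AffField} {X : AffField} (hX : Tendsto Xm atTop (𝓝 X))
    {ε : ℕ → ℝ} (hε : Tendsto ε atTop (𝓝 0)) {K : Set ℂ} (hK : IsCompact K) {δ : ℝ} (hδ : 0 < δ) :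
    ∀ᶠ m in atTop, ∀ z ∈ K, ‖flow (Xm m) (ε m) z - z‖ < δ := by
  have h := hK.eventually_forall_of_forall_eventually (x₀ := (X, (0 : ℝ)))
    (P := fun q z => ‖flow q.1 q.2 z - z‖ < δ) (by
      intro z _
      have hc : Continuous fun y : (AffField × ℝ) × ℂ => ‖flow y.1.1 y.1.2 y.2 - y.2‖ := by
        have := continuous_flow.comp (g := fun q : AffField × ℝ × ℂ => flow q.1 q.2.1 q.2.2)
          (f := fun y : (AffField × ℝ) × ℂ => (y.1.1, y.1.2, y.2)) (by fun_prop)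
        exact (this.sub continuous_snd).norm
      have := hc.tendsto ((X, (0 : ℝ)), z)
      simp only [flow_zero, sub_self, norm_zero] at this
      exact this.eventually (gt_mem_nhds hδ))
  exact (hX.prodMk_nhds hε).eventually h

/-- Local sign computation for small flow maps moving a curve off itself. -/
lemma exists_eventually_im_log_sub_pos {X₀ : AffField} {p : ℂ} {ρ R : ℝ} {ζ : AffField → ℂ → ℂ}
    (hbox : IsFlowBox X₀ p ρ R ζ) (hρ : 0 < ρ) (hv : fld X₀ p ≠ 0) {X : AffField}
    (hX : X ∈ ball X₀ ρ)
    {Xm : ℕ → AffField} (hXm : Tendsto Xm atTop (𝓝 X)) {ε : ℕ → ℝ} (hε : ∀ m, 0 < ε m)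
    (hε0 : Tendsto ε atTop (𝓝 0)) {ψ : ℝ → ℂ} {a b : ℝ} (hψ : ContinuousOn ψ (uIcc a b))
    (hB : ∀ r ∈ uIcc a b, ψ r ∈ ball p ρ) (hu : (ζ X (ψ a)).im < (ζ X (ψ b)).im) :
    ∃ η > 0, ∀ᶠ m in atTop, ∃ a' ∈ uIcc a b, η ≤ |b - a'| ∧
      ∀ Λ : ℝ × ℝ → ℂ, ContinuousOn Λ (uIcc a b ×ˢ uIcc a b) →
        (∀ s ∈ uIcc a b, ∀ t ∈ uIcc a b,
          Complex.exp (Λ (s, t)) = flow (Xm m) (ε m) (ψ s) - ψ t) →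
        0 < (Λ (b, a')).im - (Λ (a', b)).im := by
  have hcomp : IsCompact (ψ '' uIcc a b) := isCompact_uIcc.image_of_continuousOn hψ
  have haI : a ∈ uIcc a b := left_mem_uIcc
  have hbI : b ∈ uIcc a b := right_mem_uIcc
  obtain ⟨r, hr, hrB⟩ : ∃ r < ρ, ∀ s ∈ uIcc a b, dist (ψ s) p ≤ r := by
    obtain ⟨x, hx, hmax⟩ := hcomp.exists_isMaxOn ⟨_, mem_image_of_mem _ haI⟩
      (f := fun z => dist z p) (by fun_prop)
    obtain ⟨s, hs, rfl⟩ := hx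
    exact ⟨_, hB s hs, fun t ht => hmax (mem_image_of_mem _ ht)⟩
  obtain ⟨r', hrr', hr'⟩ := exists_between hr
  obtain ⟨r₁, hr₁, hr₁'⟩ : ∃ r₁ > 0, closedBall X r₁ ⊆ ball X₀ ρ := by
    obtain ⟨r₂, hr₂, h⟩ := Metric.isOpen_iff.1 isOpen_ball X hX
    exact ⟨r₂ / 2, by positivity, (closedBall_subset_ball (by linarith)).trans h⟩
  have hsub : closedBall X r₁ ×ˢ closedBall p r' ⊆ ball X₀ ρ ×ˢ ball p ρ :=
    prod_mono hr₁' (closedBall_subset_ball hr')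
  have huc := ((isCompact_closedBall X r₁).prod (isCompact_closedBall p r')).uniformContinuousOn_of_continuous
    (Complex.continuous_im.comp_continuousOn (hbox.continuousOn.mono hsub))
  set κ := (ζ X (ψ b)).im - (ζ X (ψ a)).im with hκ
  have hκ0 : 0 < κ := sub_pos.2 hu
  obtain ⟨δ, hδ, hδu⟩ := Metric.uniformContinuousOn_iff.1 huc (κ / 8) (by positivity)
  have hδu : ∀ Y ∈ closedBall X r₁, ∀ Y' ∈ closedBall X r₁, ∀ z ∈ closedBall p r', ∀ z' ∈ closedBall p r',
      dist Y Y' < δ → dist z z' < δ → |(ζ Y z).im - (ζ Y' z').im| < κ / 8 := by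
    intro Y hY Y' hY' z hz z' hz' h1 h2
    have := hδu (Y, z) ⟨hY, hz⟩ (Y', z') ⟨hY', hz'⟩ (by rw [Prod.dist_eq]; exact max_lt h1 h2)
    exact this
  obtain ⟨η, hη, hηψ⟩ := Metric.uniformContinuousOn_iff.1
    (isCompact_uIcc.uniformContinuousOn_of_continuous hψ) δ hδ
  refine ⟨η, hη, ?_⟩
  filter_upwards [hXm (ball_mem_nhds X (lt_min hδ hr₁)),
    eventually_norm_flow_sub_lt hXm hε0 hcomp (lt_min hδ (sub_pos.2 hrr')),
    hε0 (ball_mem_nhds 0 hρ)] with m hm1 hm2 hm3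
  have hm1 : dist (Xm m) X < min δ r₁ := hm1
  have hm1a : dist (Xm m) X < δ := hm1.trans_le (min_le_left _ _)
  have hm1b : Xm m ∈ closedBall X r₁ := mem_closedBall.2 (hm1.le.trans (min_le_right _ _))
  have hmX : Xm m ∈ ball X₀ ρ := hr₁' hm1b
  have hXX : X ∈ closedBall X r₁ := mem_closedBall_self hr₁.le
  have hερ : ε m < ρ := by
    have : dist (ε m) 0 < ρ := hm3
    rwa [Real.dist_eq, sub_zero, abs_of_pos (hε m)] at this
  set g := flow (Xm m) (ε m) with hgdef
  have hgd : ∀ s ∈ uIcc a b, ‖g (ψ s) - ψ s‖ < δ := fun s hs =>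
    (hm2 _ (mem_image_of_mem _ hs)).trans_le (min_le_left _ _)
  have hψB : ∀ s ∈ uIcc a b, ψ s ∈ closedBall p r' := fun s hs =>
    mem_closedBall.2 ((hrB s hs).trans hrr'.le)
  have hgB : ∀ s ∈ uIcc a b, g (ψ s) ∈ closedBall p r' := fun s hs => by
    have h1 := (hm2 _ (mem_image_of_mem _ hs)).trans_le (min_le_right _ _)
    rw [← dist_eq_norm] at h1
    have h2 := dist_triangle (g (ψ s)) (ψ s) p
    have h3 := hrB s hs
    exact mem_closedBall.2 (by linarith)
  have hBsub : closedBall p r' ⊆ ball p ρ := closedBall_subset_ball hr'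
  have huψ : ContinuousOn (fun s => (ζ (Xm m) (ψ s)).im) (uIcc a b) := by
    refine Complex.continuous_im.comp_continuousOn
      (hbox.continuousOn.comp (f := fun s => (Xm m, ψ s)) (by fun_prop) fun s hs => ⟨hmX, hB s hs⟩)
  -- The lowest point depends on `m`, as the height function does. Two errors of `κ / 8` leave a gap
  -- of `6 * (κ / 8)`, which keeps `a'` at distance at least `η` from `b`.
  obtain ⟨a', ha', hmin⟩ := isCompact_uIcc.exists_isMinOn ⟨a, haI⟩ huψ
  have hmin : ∀ s ∈ uIcc a b, (ζ (Xm m) (ψ a')).im ≤ (ζ (Xm m) (ψ s)).im := fun s hs => hmin hs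
  have hgap : 6 * (κ / 8) ≤ (ζ (Xm m) (ψ b)).im - (ζ (Xm m) (ψ a')).im := by
    have h1 := hmin a haI
    have h2 := (abs_lt.1 (hδu _ hm1b _ hXX _ (hψB a haI) _ (hψB a haI) hm1a (by simpa using hδ))).2
    have h3 := (abs_lt.1 (hδu _ hm1b _ hXX _ (hψB b hbI) _ (hψB b hbI) hm1a (by simpa using hδ))).1
    linarith
  have hself : dist (Xm m) (Xm m) < δ := by simpa using hδ
  refine ⟨a', ha', ?_, ?_⟩
  · by_contra hlt
    rw [not_le] at hlt
    have h1 := hηψ b hbI a' ha' (by rwa [Real.dist_eq])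
    have h2 := (abs_lt.1 (hδu _ hm1b _ hm1b _ (hψB b hbI) _ (hψB a' ha') hself h1)).2
    linarith
  · intro Λ hΛc hΛ
    have hsub' : uIcc a' b ⊆ uIcc a b := uIcc_subset_uIcc ha' hbI
    refine im_log_sub_pos (u := fun z => (ζ (Xm m) z).im) (B := closedBall p r') (g := g) (ψ := ψ)
      hv (hΛc.mono (prod_mono hsub' hsub')) (fun s hs t ht => hΛ s (hsub' hs) t (hsub' ht))
      (hψ.mono hsub') ?_ (fun s hs => hψB s (hsub' hs)) (fun s hs => hgB s (hsub' hs))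
      (convex_closedBall _ _) ?_ (fun s hs => hmin s (hsub' hs)) ?_ ?_ ?_
    · exact continuous_flow.comp (f := fun z : ℂ => (Xm m, ε m, z)) (by fun_prop)
    · intro s hs
      have := hbox.shift _ hmX _ (hB s (hsub' hs)) (ε m) (by rwa [abs_of_pos (hε m)])
      simp only [hgdef]
      rw [this]; simp
    · intro z hz w hw s hs h
      exact hbox.im_lt _ hmX z (hBsub hz) w (hBsub hw) s hs h
    · exact hbox.re_pos _ hmX _ (hB a' ha') _ (hε m) hερ
    · intro t ht
      have hcomb : ∀ x ∈ closedBall p r', ∀ y ∈ closedBall p r',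
          ((1 - t) * x + t * y : ℂ) ∈ closedBall p r' := by
        intro x hx y hy
        have := (convex_closedBall p r') hx hy (a := 1 - t) (b := t) (by linarith [ht.2]) ht.1 (by ring)
        simpa using this
      have hd0 : dist ((1 - t) * ψ a' + t * g (ψ a') : ℂ) (ψ a') < δ := by
        have e : ((1 - t) * ψ a' + t * g (ψ a') : ℂ) - ψ a' = t * (g (ψ a') - ψ a') := by ring
        rw [dist_eq_norm, e, norm_mul, Complex.norm_real, Real.norm_eq_abs, abs_of_nonneg ht.1]
        have := hgd a' ha'
        have h0 := norm_nonneg (g (ψ a') - ψ a')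
        nlinarith [ht.2]
      have hd1 : dist ((1 - t) * g (ψ b) + t * ψ b : ℂ) (ψ b) < δ := by
        have e : ((1 - t) * g (ψ b) + t * ψ b : ℂ) - ψ b = ((1 - t : ℝ) : ℂ) * (g (ψ b) - ψ b) := by
          push_cast; ring
        rw [dist_eq_norm, e, norm_mul, Complex.norm_real, Real.norm_eq_abs,
          abs_of_nonneg (by linarith [ht.2])]
        have := hgd b hbI
        have h0 := norm_nonneg (g (ψ b) - ψ b)
        nlinarith [ht.1]
      have h1 := (abs_lt.1 (hδu _ hm1b _ hm1b _ (hcomb _ (hψB a' ha') _ (hgB a' ha')) _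
        (hψB a' ha') hself hd0)).2
      have h2 := (abs_lt.1 (hδu _ hm1b _ hm1b _ (hcomb _ (hgB b hbI) _ (hψB b hbI)) _
        (hψB b hbI) hself hd1)).1
      linarith

/-- Injectivity made quantitative by compactness: points close on the arc have close parameters. -/
lemma exists_norm_sub_ge {ψ : ℝ → ℂ} {α β : ℝ} (hψ : ContinuousOn ψ (Icc α β))
    (hinj : InjOn ψ (Icc α β)) {η : ℝ} (hη : 0 < η) :
    ∃ μ > 0, ∀ s ∈ Icc α β, ∀ t ∈ Icc α β, η ≤ |s - t| → μ ≤ ‖ψ s - ψ t‖ := by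
  set K := (Icc α β ×ˢ Icc α β) ∩ {q : ℝ × ℝ | η ≤ |q.1 - q.2|} with hK
  have hKc : IsCompact K := (isCompact_Icc.prod isCompact_Icc).inter_right
    (isClosed_le continuous_const (by fun_prop))
  have hc : ContinuousOn (fun q : ℝ × ℝ => ‖ψ q.1 - ψ q.2‖) K := by
    refine ContinuousOn.norm (ContinuousOn.sub ?_ ?_)
    · exact hψ.comp (by fun_prop) fun q hq => hq.1.1
    · exact hψ.comp (by fun_prop) fun q hq => hq.1.2
  rcases K.eq_empty_or_nonempty with h | h
  · refine ⟨1, one_pos, fun s hs t ht hst => ?_⟩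
    have : (s, t) ∈ K := ⟨⟨hs, ht⟩, hst⟩
    rw [h] at this
    exact absurd this (notMem_empty _)
  · obtain ⟨q, hq, hmin⟩ := hKc.exists_isMinOn h hc
    refine ⟨_, ?_, fun s hs t ht hst => hmin (a := (s, t)) ⟨⟨hs, ht⟩, hst⟩⟩
    rw [gt_iff_lt, norm_pos_iff, sub_ne_zero]
    intro e
    have := hinj hq.1.1 hq.1.2 e
    have h2 : η ≤ |q.1 - q.2| := hq.2
    rw [this, sub_self, abs_zero] at h2
    linarith

/-- If arbitrarily small flow maps move an arc off itself, the arc cannot cross the flow lines in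
both directions. -/
lemma false_of_opposite_crossing {X₁ X₂ : AffField} {p₁ p₂ : ℂ} {ρ₁ R₁ ρ₂ R₂ : ℝ}
    {ζ₁ ζ₂ : AffField → ℂ → ℂ}
    (hbox₁ : IsFlowBox X₁ p₁ ρ₁ R₁ ζ₁) (hρ₁ : 0 < ρ₁) (hv₁ : fld X₁ p₁ ≠ 0)
    (hbox₂ : IsFlowBox X₂ p₂ ρ₂ R₂ ζ₂) (hρ₂ : 0 < ρ₂) (hv₂ : fld X₂ p₂ ≠ 0) {X : AffField}
    (hX₁ : X ∈ ball X₁ ρ₁) (hX₂ : X ∈ ball X₂ ρ₂)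
    {Xm : ℕ → AffField} (hXm : Tendsto Xm atTop (𝓝 X)) {ε : ℕ → ℝ} (hε : ∀ m, 0 < ε m)
    (hε0 : Tendsto ε atTop (𝓝 0)) {ψ : ℝ → ℂ} {α β : ℝ} (hψ : ContinuousOn ψ (Icc α β))
    (hinj : InjOn ψ (Icc α β))
    (hcross : ∀ᶠ m in atTop, ∀ s ∈ Icc α β, ∀ t ∈ Icc α β, flow (Xm m) (ε m) (ψ s) ≠ ψ t)
    {a₀ a₁ b₀ b₁ : ℝ} (ha₀ : a₀ ∈ Icc α β) (ha₁ : a₁ ∈ Icc α β) (hb₀ : b₀ ∈ Icc α β)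
    (hb₁ : b₁ ∈ Icc α β) (ha : a₀ < a₁) (hb : b₁ < b₀)
    (hBa : ∀ r ∈ uIcc a₀ a₁, ψ r ∈ ball p₁ ρ₁) (hBb : ∀ r ∈ uIcc b₀ b₁, ψ r ∈ ball p₂ ρ₂)
    (hua : (ζ₁ X (ψ a₀)).im < (ζ₁ X (ψ a₁)).im) (hub : (ζ₂ X (ψ b₀)).im < (ζ₂ X (ψ b₁)).im) :
    False := by
  have hsa : uIcc a₀ a₁ ⊆ Icc α β := uIcc_subset_Icc ha₀ ha₁
  have hsb : uIcc b₀ b₁ ⊆ Icc α β := uIcc_subset_Icc hb₀ hb₁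
  obtain ⟨η₁, hη₁, hev₁⟩ := exists_eventually_im_log_sub_pos hbox₁ hρ₁ hv₁ hX₁ hXm hε hε0
    (hψ.mono hsa) hBa hua
  obtain ⟨η₂, hη₂, hev₂⟩ := exists_eventually_im_log_sub_pos hbox₂ hρ₂ hv₂ hX₂ hXm hε hε0
    (hψ.mono hsb) hBb hub
  obtain ⟨μ, hμ, hμψ⟩ := exists_norm_sub_ge hψ hinj (lt_min hη₁ hη₂)
  obtain ⟨m, ⟨⟨h1, h2⟩, h3⟩, h4⟩ := (((hev₁.and hev₂).and hcross).and
    (eventually_norm_flow_sub_lt hXm hε0 (isCompact_Icc.image_of_continuousOn hψ)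
      (show 0 < μ / 3 by positivity))).exists
  obtain ⟨a', ha', hηa, hKa⟩ := h1
  obtain ⟨b', hb', hηb, hKb⟩ := h2
  set g := flow (Xm m) (ε m) with hg
  have hgc : Continuous g := continuous_flow.comp (f := fun z : ℂ => (Xm m, ε m, z)) (by fun_prop)
  have hgψ : ContinuousOn (fun s => g (ψ s)) (Icc α β) := hgc.comp_continuousOn hψ
  obtain ⟨Λ, hΛc, hΛ⟩ := exists_continuousOn_log (K := Icc α β ×ˢ Icc α β)
    (F := fun q : ℝ × ℝ => g (ψ q.1) - ψ q.2) (isCompact_Icc.prod isCompact_Icc)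
    ((convex_Icc α β).prod (convex_Icc α β))
    ((hgψ.comp continuous_fst.continuousOn fun q hq => hq.1).sub
      (hψ.comp continuous_snd.continuousOn fun q hq => hq.2))
    (fun q hq => sub_ne_zero.2 (h3 _ hq.1 _ hq.2))
  have hKa := hKa Λ (hΛc.mono (prod_mono hsa hsa)) fun s hs t ht => hΛ (s, t) ⟨hsa hs, hsa ht⟩
  have hKb := hKb Λ (hΛc.mono (prod_mono hsb hsb)) fun s hs t ht => hΛ (s, t) ⟨hsb hs, hsb ht⟩
  have ha'α := hsa ha'
  have hb'α := hsb hb'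
  have haη : η₁ ≤ a₁ - a' := by
    rw [uIcc_of_le ha.le] at ha'
    rwa [abs_of_nonneg (by linarith [ha'.2])] at hηa
  have hbη : η₂ ≤ b' - b₁ := by
    rw [uIcc_of_ge hb.le] at hb'
    rwa [abs_sub_comm, abs_of_nonneg (by linarith [hb'.1])] at hηb
  -- The path `(S, T)` leads from `(a', a₁)` to `(b₁, b')` on one side of the diagonal. The argument
  -- at `(T, S)` minus that at `(S, T)` is positive at the start and negative at the end.
  set S : ℝ → ℝ := fun l => (1 - l) * a' + l * b₁ with hS
  set T : ℝ → ℝ := fun l => (1 - l) * a₁ + l * b' with hT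
  have hcomb : ∀ x ∈ Icc α β, ∀ y ∈ Icc α β, ∀ l ∈ Icc (0 : ℝ) 1, (1 - l) * x + l * y ∈ Icc α β := by
    intro x hx y hy l hl
    exact (convex_Icc α β) hx hy (a := 1 - l) (b := l) (by linarith [hl.2]) hl.1 (by ring)
  have hSm : ∀ l ∈ Icc (0 : ℝ) 1, S l ∈ Icc α β := hcomb _ ha'α _ hb₁
  have hTm : ∀ l ∈ Icc (0 : ℝ) 1, T l ∈ Icc α β := hcomb _ ha₁ _ hb'α
  have hST : ∀ l ∈ Icc (0 : ℝ) 1, min η₁ η₂ ≤ |S l - T l| := by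
    intro l hl
    have h5 : min η₁ η₂ ≤ T l - S l := by
      have e : T l - S l = (1 - l) * (a₁ - a') + l * (b' - b₁) := by simp only [hS, hT]; ring
      rw [e]
      have := min_le_left η₁ η₂
      have := min_le_right η₁ η₂
      nlinarith [hl.1, hl.2]
    rw [abs_sub_comm]
    exact h5.trans (le_abs_self _)
  have hKc : ContinuousOn (fun l => (Λ (T l, S l)).im - (Λ (S l, T l)).im) (Icc 0 1) := by
    refine ContinuousOn.sub ?_ ?_
    · exact Complex.continuous_im.comp_continuousOn
        (hΛc.comp (f := fun l => (T l, S l)) (by fun_prop) fun l hl => ⟨hTm l hl, hSm l hl⟩)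
    · exact Complex.continuous_im.comp_continuousOn
        (hΛc.comp (f := fun l => (S l, T l)) (by fun_prop) fun l hl => ⟨hSm l hl, hTm l hl⟩)
  obtain ⟨l, hl, hl0⟩ := intermediate_value_Icc' zero_le_one hKc
    (show (0 : ℝ) ∈ _ by constructor <;> simp [hS, hT] <;> linarith)
  have e1 : Complex.exp (Λ (T l, S l)) = g (ψ (T l)) - ψ (S l) := hΛ (T l, S l) ⟨hTm l hl, hSm l hl⟩
  have e2 : Complex.exp (Λ (S l, T l)) = g (ψ (S l)) - ψ (T l) := hΛ (S l, T l) ⟨hSm l hl, hTm l hl⟩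
  -- At the zero, `g (ψ (T l)) - ψ (S l)` and `g (ψ (S l)) - ψ (T l)` point the same way, while they
  -- are close to the opposite vectors `±(ψ (T l) - ψ (S l))`, of length at least `μ`.
  have hsame : Complex.exp (Λ (T l, S l)) =
      (Real.exp ((Λ (T l, S l)).re - (Λ (S l, T l)).re) : ℝ) * Complex.exp (Λ (S l, T l)) := by
    rw [Complex.ofReal_exp, ← Complex.exp_add]
    congr 1
    apply Complex.ext
    · simp
    · simp; linarith
  rw [e1, e2] at hsame
  set c := Real.exp ((Λ (T l, S l)).re - (Λ (S l, T l)).re)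
  have hc : 0 < c := Real.exp_pos _
  have n1 := h4 _ (mem_image_of_mem ψ (hSm l hl))
  have n2 := h4 _ (mem_image_of_mem ψ (hTm l hl))
  have n3 := hμψ _ (hSm l hl) _ (hTm l hl) (hST l hl)
  set P := g (ψ (S l))
  set Q := g (ψ (T l))
  set x := ψ (S l)
  set y := ψ (T l)
  have k1 : ((1 + c : ℝ) : ℂ) * (x - y) = (Q - y) - (c : ℂ) * (P - x) := by
    push_cast
    linear_combination (-1 : ℂ) * hsame
  have k2 : (1 + c) * ‖x - y‖ ≤ μ / 3 + c * (μ / 3) := by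
    have h5 := congrArg norm k1
    rw [norm_mul, Complex.norm_real, Real.norm_eq_abs, abs_of_pos (by linarith)] at h5
    rw [h5]
    refine (norm_sub_le _ _).trans ?_
    rw [norm_mul, Complex.norm_real, Real.norm_eq_abs, abs_of_pos hc]
    gcongr
  nlinarith

end AffField

/-! ### Subarcs and their parametrisations. -/

/-- Continuous lifts through an injective arc. -/
lemma exists_lift_arc {c : ℝ → ℂ} {a b : ℝ} (hc : ContinuousOn c (Icc a b))
    (hinj : InjOn c (Icc a b)) {e : ℝ → ℂ} {T : Set ℝ} (he : ContinuousOn e T)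
    (hmaps : MapsTo e T (c '' Icc a b)) :
    ∃ h : ℝ → ℝ, ContinuousOn h T ∧ MapsTo h T (Icc a b) ∧ ∀ x ∈ T, c (h x) = e x := by
  have hex : ∀ x, ∃ y, x ∈ T → y ∈ Icc a b ∧ c y = e x := fun x => by
    by_cases hx : x ∈ T
    · obtain ⟨y, hy⟩ := hmaps hx
      exact ⟨y, fun _ => hy⟩
    · exact ⟨0, fun h => absurd h hx⟩
  choose h hh using hex
  refine ⟨h, ?_, fun x hx => (hh x hx).1, fun x hx => (hh x hx).2⟩
  rw [Metric.continuousOn_iff]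
  intro x hx η hη
  obtain ⟨μ, hμ, hμc⟩ := AffField.exists_norm_sub_ge hc hinj hη
  obtain ⟨δ, hδ, hδe⟩ := Metric.continuousOn_iff.1 he x hx μ hμ
  refine ⟨δ, hδ, fun y hy hxy => ?_⟩
  by_contra hcon
  rw [not_lt, Real.dist_eq] at hcon
  have h1 := hμc _ (hh y hy).1 _ (hh x hx).1 hcon
  have h2 := hδe y hy hxy
  rw [(hh y hy).2, (hh x hx).2, ← dist_eq_norm] at h1
  linarith

lemma injOn_of_lift {c : ℝ → ℂ} {e : ℝ → ℂ} {h : ℝ → ℝ} {T : Set ℝ} (he : InjOn e T)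
    (hh : ∀ x ∈ T, c (h x) = e x) : InjOn h T := fun x hx y hy hxy =>
  he hx hy (by rw [← hh x hx, ← hh y hy, hxy])

/-- Range of a continuous injective function on a compact interval. -/
lemma image_Icc_eq_uIcc {k : ℝ → ℝ} {a b : ℝ} (hab : a ≤ b) (hk : ContinuousOn k (Icc a b))
    (hinj : InjOn k (Icc a b)) : k '' Icc a b = uIcc (k a) (k b) := by
  apply Subset.antisymm
  · rintro _ ⟨s, hs, rfl⟩
    rcases hk.strictMonoOn_of_injOn_Icc' hab hinj with h | h
    · have := h.monotoneOn
      rw [mem_uIcc]; left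
      exact ⟨this (left_mem_Icc.2 hab) hs hs.1, this hs (right_mem_Icc.2 hab) hs.2⟩
    · have := h.antitoneOn
      rw [mem_uIcc]; right
      exact ⟨this hs (right_mem_Icc.2 hab) hs.2, this (left_mem_Icc.2 hab) hs hs.1⟩
  · have := intermediate_value_uIcc (f := k) (a := a) (b := b) (by rwa [uIcc_of_le hab])
    rwa [uIcc_of_le hab] at this

lemma exists_endpoint_mem_uIcc {x y c d : ℝ} (hx : x ∈ uIcc c d) (hy : y ∉ uIcc c d) :
    c ∈ uIcc x y ∨ d ∈ uIcc x y := by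
  simp only [mem_uIcc] at *
  grind

/-- Two parametrized subarcs `φ ∘ h = i ∘ φ` and `φ ∘ k = j ∘ φ` of a given arc. -/
structure SubarcPair (φ : ℝ → ℂ) (i j f : ℂ ≃ᵃ[ℝ] ℂ) (h k : ℝ → ℝ) : Prop where
  inj : InjOn φ (Icc 0 1)
  conj : ∀ z, j (f z) = i z
  contL : ContinuousOn h (Icc 0 1)
  contR : ContinuousOn k (Icc 0 1)
  mapsL : MapsTo h (Icc 0 1) (Icc 0 1)
  mapsR : MapsTo k (Icc 0 1) (Icc 0 1)
  eqL : ∀ s ∈ Icc (0 : ℝ) 1, φ (h s) = i (φ s)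
  eqR : ∀ s ∈ Icc (0 : ℝ) 1, φ (k s) = j (φ s)

namespace SubarcPair

lemma exists_of_mapsTo {φ : ℝ → ℂ} {i j f : ℂ ≃ᵃ[ℝ] ℂ} (hφ : Continuous φ)
    (hinj : InjOn φ (Icc 0 1)) (hi : MapsTo i (φ '' Icc 0 1) (φ '' Icc 0 1))
    (hj : MapsTo j (φ '' Icc 0 1) (φ '' Icc 0 1)) (hf : ∀ z, j (f z) = i z) :
    ∃ h k, SubarcPair φ i j f h k := by
  obtain ⟨h, h1, h2, h3⟩ := exists_lift_arc hφ.continuousOn hinj (T := Icc 0 1) (e := fun s => i (φ s))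
    ((AffField.continuous_affine i).comp hφ).continuousOn (fun s hs => hi (mem_image_of_mem _ hs))
  obtain ⟨k, k1, k2, k3⟩ := exists_lift_arc hφ.continuousOn hinj (T := Icc 0 1) (e := fun s => j (φ s))
    ((AffField.continuous_affine j).comp hφ).continuousOn (fun s hs => hj (mem_image_of_mem _ hs))
  exact ⟨h, k, hinj, hf, h1, k1, h2, k2, h3, k3⟩

variable {φ : ℝ → ℂ} {i j f : ℂ ≃ᵃ[ℝ] ℂ} {h k : ℝ → ℝ}

lemma injOnL (P : SubarcPair φ i j f h k) : InjOn h (Icc 0 1) :=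
  injOn_of_lift (fun _ hs _ ht hst => P.inj hs ht (i.injective hst)) P.eqL

lemma injOnR (P : SubarcPair φ i j f h k) : InjOn k (Icc 0 1) :=
  injOn_of_lift (fun _ hs _ ht hst => P.inj hs ht (j.injective hst)) P.eqR

/-- Applying `j` turns intersections of `f ∘ φ` with `φ` into coincidences of two real functions. -/
lemma eq_iff (P : SubarcPair φ i j f h k) {s t : ℝ} (hs : s ∈ Icc (0 : ℝ) 1) (ht : t ∈ Icc (0 : ℝ) 1) :
    f (φ s) = φ t ↔ h s = k t := by
  constructor
  · intro e
    apply P.inj (P.mapsL hs) (P.mapsR ht)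
    rw [P.eqL s hs, P.eqR t ht, ← e, P.conj]
  · intro e
    apply j.injective
    rw [P.conj, ← P.eqL s hs, e, P.eqR t ht]

lemma mem_iff (P : SubarcPair φ i j f h k) {s : ℝ} (hs : s ∈ Icc (0 : ℝ) 1) :
    f (φ s) ∈ φ '' Icc 0 1 ↔ h s ∈ k '' Icc 0 1 := by
  constructor
  · rintro ⟨t, ht, e⟩
    exact ⟨t, ht, ((P.eq_iff hs ht).1 e.symm).symm⟩
  · rintro ⟨t, ht, e⟩
    exact ⟨t, ht, ((P.eq_iff hs ht).2 e.symm).symm⟩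

/-- A coincidence would make `f` move `φ s` to `φ t`, which is too far away. -/
lemma ne_endpoint (P : SubarcPair φ i j f h k) {δ η : ℝ}
    (hη : ∀ s ∈ Icc (0 : ℝ) 1, ∀ t ∈ Icc (0 : ℝ) 1, δ ≤ |s - t| → η ≤ ‖φ s - φ t‖)
    (hclose : ∀ s ∈ Icc (0 : ℝ) 1, ‖f (φ s) - φ s‖ < η) {s t : ℝ} (hs : s ∈ Icc (0 : ℝ) 1)
    (ht : t ∈ Icc (0 : ℝ) 1) (hst : δ ≤ |s - t|) : h s ≠ k t := by
  intro e
  have h1 := (P.eq_iff hs ht).2 e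
  have h2 := hη s hs t ht hst
  have h3 := hclose s hs
  rw [h1, norm_sub_rev] at h3
  linarith

/-- A map close to the identity moves either all or none of the middle part of the arc into the
arc. -/
lemma mem_of_mem (P : SubarcPair φ i j f h k) {δ η : ℝ} (hδ : 0 ≤ δ)
    (hη : ∀ s ∈ Icc (0 : ℝ) 1, ∀ t ∈ Icc (0 : ℝ) 1, δ ≤ |s - t| → η ≤ ‖φ s - φ t‖)
    (hclose : ∀ s ∈ Icc (0 : ℝ) 1, ‖f (φ s) - φ s‖ < η) {s₀ s : ℝ} (hs₀ : s₀ ∈ Icc δ (1 - δ))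
    (hs : s ∈ Icc δ (1 - δ)) (hmem : f (φ s₀) ∈ φ '' Icc 0 1) : f (φ s) ∈ φ '' Icc 0 1 := by
  have hsub : Icc δ (1 - δ) ⊆ Icc (0 : ℝ) 1 := Icc_subset_Icc hδ (by linarith)
  have himg := image_Icc_eq_uIcc zero_le_one P.contR P.injOnR
  rw [P.mem_iff (hsub hs₀), himg] at hmem
  rw [P.mem_iff (hsub hs), himg]
  by_contra hcon
  have hsub2 : uIcc s₀ s ⊆ Icc δ (1 - δ) := uIcc_subset_Icc hs₀ hs
  have hivt := intermediate_value_uIcc (P.contL.mono (hsub2.trans hsub))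
  -- To leave the range of `k`, the function `h` must pass through `k 0` or `k 1` at a parameter in
  -- `[δ, 1 - δ]`, far from both `0` and `1`.
  rcases exists_endpoint_mem_uIcc hmem hcon with h1 | h1
  · obtain ⟨s', hs', e⟩ := hivt h1
    refine P.ne_endpoint hη hclose (hsub (hsub2 hs')) ⟨le_rfl, zero_le_one⟩ ?_ e
    rw [sub_zero]; exact (hsub2 hs').1.trans (le_abs_self _)
  · obtain ⟨s', hs', e⟩ := hivt h1
    refine P.ne_endpoint hη hclose (hsub (hsub2 hs')) ⟨zero_le_one, le_rfl⟩ ?_ e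
    rw [abs_sub_comm]
    have := (hsub2 hs').2
    exact (show δ ≤ 1 - s' by linarith).trans (le_abs_self _)

end SubarcPair

/-- Two increasing functions whose ranges meet, but with some middle value of the first one outside
the range of the second one. -/
lemma exists_eq_endpoint_of_strictMonoOn {h k : ℝ → ℝ} (hh : ContinuousOn h (Icc 0 1))
    (hk : ContinuousOn k (Icc 0 1)) (mh : StrictMonoOn h (Icc 0 1)) (mk : StrictMonoOn k (Icc 0 1))
    {s t r : ℝ} (hs : s ∈ Icc (0 : ℝ) 1) (ht : t ∈ Icc (0 : ℝ) 1) (hst : h s = k t)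
    (hr : r ∈ Icc (0 : ℝ) 1) (hrk : h r ∉ k '' Icc 0 1) :
    ∃ s' ∈ Icc (0 : ℝ) 1, (r ≤ s' ∧ h s' = k 0) ∨ (s' ≤ r ∧ h s' = k 1) := by
  have h0 : (0 : ℝ) ∈ Icc (0 : ℝ) 1 := ⟨le_rfl, zero_le_one⟩
  have h1 : (1 : ℝ) ∈ Icc (0 : ℝ) 1 := ⟨zero_le_one, le_rfl⟩
  have hout : h r < k 0 ∨ k 1 < h r := by
    by_contra hcon
    rw [not_or, not_lt, not_lt] at hcon
    exact hrk (intermediate_value_Icc zero_le_one hk hcon)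
  have hk0 : k 0 ≤ k t := mk.monotoneOn h0 ht ht.1
  have hk1 : k t ≤ k 1 := mk.monotoneOn ht h1 ht.2
  rcases hout with ho | ho
  · have hrs : r ≤ s := ((mh.lt_iff_lt hr hs).1 (by linarith)).le
    obtain ⟨s', hs', e⟩ := intermediate_value_Icc hrs (hh.mono (Icc_subset_Icc hr.1 hs.2))
      (show k 0 ∈ Icc (h r) (h s) from ⟨ho.le, by linarith⟩)
    exact ⟨s', ⟨hr.1.trans hs'.1, hs'.2.trans hs.2⟩, Or.inl ⟨hs'.1, e⟩⟩
  · have hrs : s ≤ r := ((mh.lt_iff_lt hs hr).1 (by linarith)).le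
    obtain ⟨s', hs', e⟩ := intermediate_value_Icc hrs (hh.mono (Icc_subset_Icc hs.1 hr.2))
      (show k 1 ∈ Icc (h s) (h r) from ⟨by linarith, ho.le⟩)
    exact ⟨s', ⟨hs.1.trans hs'.1, hs'.2.trans hr.2⟩, Or.inr ⟨hs'.2, e⟩⟩

namespace SubarcPair

variable {φ : ℝ → ℂ} {i j f : ℂ ≃ᵃ[ℝ] ℂ} {h k : ℝ → ℝ}

/-- If a map close to the identity moves the midpoint off the arc, the two subarcs are oppositely
oriented. -/
lemma opposite (P : SubarcPair φ i j f h k) {η : ℝ}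
    (hη : ∀ s ∈ Icc (0 : ℝ) 1, ∀ t ∈ Icc (0 : ℝ) 1, 1 / 2 ≤ |s - t| → η ≤ ‖φ s - φ t‖)
    (hclose : ∀ s ∈ Icc (0 : ℝ) 1, ‖f (φ s) - φ s‖ < η) (hhalf : f (φ (1 / 2)) ∉ φ '' Icc 0 1)
    (hmeet : ∃ s ∈ Icc (0 : ℝ) 1, f (φ s) ∈ φ '' Icc 0 1) {s t : ℝ} (hs : s ∈ Icc (0 : ℝ) 1)
    (ht : t ∈ Icc (0 : ℝ) 1) (hst : s ≠ t) :
    (h s < h t ∧ k t < k s) ∨ (h t < h s ∧ k s < k t) := by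
  have hr : (1 / 2 : ℝ) ∈ Icc (0 : ℝ) 1 := by constructor <;> norm_num
  have h0 : (0 : ℝ) ∈ Icc (0 : ℝ) 1 := ⟨le_rfl, zero_le_one⟩
  have h1 : (1 : ℝ) ∈ Icc (0 : ℝ) 1 := ⟨zero_le_one, le_rfl⟩
  obtain ⟨σ, hσ, τ, hτ, e⟩ := hmeet
  have e1 : h σ = k τ := (P.eq_iff hσ hτ).1 e.symm
  rw [P.mem_iff hr] at hhalf
  have hend : ∀ s' ∈ Icc (0 : ℝ) 1, ¬ ((1 / 2 ≤ s' ∧ h s' = k 0) ∨ (s' ≤ 1 / 2 ∧ h s' = k 1)) := by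
    rintro s' hs' (⟨h3, h4⟩ | ⟨h3, h4⟩)
    · refine P.ne_endpoint hη hclose hs' h0 ?_ h4
      rw [sub_zero]; exact h3.trans (le_abs_self _)
    · refine P.ne_endpoint hη hclose hs' h1 ?_ h4
      rw [abs_sub_comm]; exact (show 1 / 2 ≤ 1 - s' by linarith).trans (le_abs_self _)
  -- If `h` and `k` were both increasing, `h` would reach `k 0` after `1/2` or `k 1` before it,
  -- which `hend` excludes; two decreasing functions are handled by negation.
  rcases P.contL.strictMonoOn_of_injOn_Icc' zero_le_one P.injOnL with mh | mh <;>
    rcases P.contR.strictMonoOn_of_injOn_Icc' zero_le_one P.injOnR with mk | mk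
  · obtain ⟨s', hs', h2⟩ := exists_eq_endpoint_of_strictMonoOn P.contL P.contR mh mk hσ hτ e1 hr hhalf
    exact absurd h2 (hend s' hs')
  · rcases lt_or_gt_of_ne hst with h2 | h2
    · exact Or.inl ⟨mh hs ht h2, mk hs ht h2⟩
    · exact Or.inr ⟨mh ht hs h2, mk ht hs h2⟩
  · rcases lt_or_gt_of_ne hst with h2 | h2
    · exact Or.inr ⟨mh hs ht h2, mk hs ht h2⟩
    · exact Or.inl ⟨mh ht hs h2, mk ht hs h2⟩
  · obtain ⟨s', hs', h2⟩ := exists_eq_endpoint_of_strictMonoOn (h := fun s => -h s) (k := fun s => -k s)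
      P.contL.neg P.contR.neg (fun a ha b hb hab => neg_lt_neg (mh ha hb hab))
      (fun a ha b hb hab => neg_lt_neg (mk ha hb hab)) hσ hτ (by rw [e1]) hr (by
        rintro ⟨x, hx, e2⟩
        exact hhalf ⟨x, hx, neg_injective e2⟩)
    simp only [neg_inj] at h2
    exact absurd h2 (hend s' hs')

end SubarcPair

/-! ### Generating fields and the shift case. -/

namespace AffField

/-- A sequence of affine maps tending to the identity consists, along a subsequence, of small flow
maps of a convergent sequence of affine vector fields with nonzero limit. -/
lemma exists_generators {f : ℕ → ℂ ≃ᵃ[ℝ] ℂ} (hne : ∀ n, f n ≠ 1)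
    (hlim : ∀ z, Tendsto (fun n => f n z) atTop (𝓝 z)) :
    ∃ θ : ℕ → ℕ, StrictMono θ ∧ ∃ (Xn : ℕ → AffField) (X : AffField) (ε : ℕ → ℝ), X ≠ 0 ∧
      (∀ n, 0 < ε n) ∧ Tendsto ε atTop (𝓝 0) ∧ Tendsto Xn atTop (𝓝 X) ∧
      ∀ n z, f (θ n) z = flow (Xn n) (ε n) z := by
  obtain ⟨lg, hlg, hflow⟩ := exists_log
  have hw : Tendsto (fun n => displacement (f n)) atTop (𝓝 0) := by
    refine tendsto_zero_of_fld fun z => ?_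
    simp only [fld_displacement]
    simpa using (hlim z).sub_const z
  obtain ⟨N, hN⟩ := eventually_atTop.1 (hw.eventually hflow)
  have hN' : ∀ n, ∀ z, flow (lg (displacement (f (n + N)))) 1 z = f (n + N) z := by
    intro n z
    rw [hN (n + N) (by omega) z, fld_displacement]
    ring
  set Y : ℕ → AffField := fun n => lg (displacement (f (n + N))) with hY
  have hY0 : Tendsto Y atTop (𝓝 0) := (hlg.comp hw).comp (tendsto_add_atTop_nat N)
  have hYne : ∀ n, Y n ≠ 0 := by
    intro n h
    apply hne (n + N)
    ext z
    have h1 := hN' n z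
    have h3 : flow (Y n) 1 z = z := (eq_flow_of_hasDerivAt (c := fun _ => z) (fun t => by
      have h2 : fld (Y n) z = 0 := by rw [h]; simp [fld]
      rw [h2]; exact hasDerivAt_const t z) 1).symm
    rw [← h1]
    exact h3
  have hsph : ∀ n, ‖Y n‖⁻¹ • Y n ∈ sphere (0 : AffField) 1 := by
    intro n
    rw [mem_sphere_zero_iff_norm, norm_smul, norm_inv, norm_norm,
      inv_mul_cancel₀ (norm_ne_zero_iff.2 (hYne n))]
  have : ProperSpace AffField := FiniteDimensional.proper_real AffField
  -- Normalising the logarithms to norm 1 keeps the limit nonzero; their norms become the flow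
  -- times.
  obtain ⟨X, hX, κ, hκ, hXlim⟩ := (isCompact_sphere (0 : AffField) 1).tendsto_subseq hsph
  refine ⟨fun n => κ n + N, fun a b hab => Nat.add_lt_add_right (hκ hab) N,
    fun n => ‖Y (κ n)‖⁻¹ • Y (κ n), X, fun n => ‖Y (κ n)‖, ?_, ?_, ?_, hXlim, ?_⟩
  · rintro rfl
    simp at hX
  · exact fun n => norm_pos_iff.2 (hYne _)
  · have := (hY0.comp hκ.tendsto_atTop).norm
    simpa using this
  · intro n z
    rw [flow_smul, mul_inv_cancel₀ (norm_ne_zero_iff.2 (hYne _))]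
    exact (hN' (κ n) z).symm

/-- The set is contained in a line. -/
def InLine (γ : Set ℂ) : Prop := ∃ l : ℂ →L[ℝ] ℝ, l ≠ 0 ∧ ∃ c, ∀ z ∈ γ, l z = c

/-- The linear part cannot vanish, so its real or imaginary component is a nonzero functional,
constant on the zeros. -/
lemma inLine_of_fld_eq_zero {X : AffField} (hX : X ≠ 0) {γ : Set ℂ} (hγ : γ.Nonempty)
    (h : ∀ z ∈ γ, fld X z = 0) : InLine γ := by
  have h1 : X.1 ≠ 0 := by
    intro h1
    obtain ⟨z, hz⟩ := hγ
    have h2 := h z hz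
    simp only [fld, h1, zero_apply, zero_add] at h2
    exact hX (Prod.ext h1 h2)
  have h3 : ∀ z ∈ γ, X.1 z = -X.2 := fun z hz => eq_neg_of_add_eq_zero_left (h z hz)
  by_cases hre : Complex.reCLM ∘L X.1 = 0
  · refine ⟨Complex.imCLM ∘L X.1, ?_, (-X.2).im, fun z hz => by simp [h3 z hz]⟩
    intro him
    apply h1
    ext z
    exact Complex.ext (by simpa using DFunLike.congr_fun hre z)
      (by simpa using DFunLike.congr_fun him z)
  · exact ⟨_, hre, (-X.2).re, fun z hz => by simp [h3 z hz]⟩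

/-- Some subarc is contained in an injectively parametrized piece of a flow line of an affine
vector field. -/
def HasOrbitSubarc (φ : ℝ → ℂ) : Prop :=
  ∃ (X : AffField) (q : ℂ) (r a b : ℝ), 0 ≤ a ∧ a < b ∧ b ≤ 1 ∧
    InjOn (fun t => flow X t q) (Icc (-r) r) ∧ φ '' Icc a b ⊆ (fun t => flow X t q) '' Icc (-r) r

lemma exists_fld_ne_zero {X : AffField} (hX : X ≠ 0) {φ : ℝ → ℂ} (hφ : Continuous φ)
    (hl : ¬ InLine (φ '' Icc 0 1)) : ∃ s ∈ Ioo (0 : ℝ) 1, fld X (φ s) ≠ 0 := by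
  by_contra! hcon
  apply hl
  refine inLine_of_fld_eq_zero hX ⟨_, mem_image_of_mem _ ⟨le_rfl, zero_le_one⟩⟩ ?_
  have hc : IsClosed {s | fld X (φ s) = 0} :=
    isClosed_eq (by unfold fld; fun_prop) continuous_const
  have h1 : closure (Ioo (0 : ℝ) 1) ⊆ {s | fld X (φ s) = 0} := hc.closure_subset_iff.2 hcon
  rw [closure_Ioo zero_ne_one] at h1
  rintro _ ⟨s, hs, rfl⟩
  exact h1 hs

/-- An arc which is shifted along itself by small flow maps contains a piece of a flow line. -/
lemma hasOrbitSubarc_of_shift {φ : ℝ → ℂ} (hφ : Continuous φ) (hinj : InjOn φ (Icc 0 1))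
    {Xn : ℕ → AffField} {X : AffField} (hXn : Tendsto Xn atTop (𝓝 X)) {ε : ℕ → ℝ}
    (hε : ∀ n, 0 < ε n) (hε0 : Tendsto ε atTop (𝓝 0))
    (hshift : ∀ δ > 0, δ < 1 / 2 → ∀ᶠ n in atTop, ∀ s ∈ Icc δ (1 - δ),
      flow (Xn n) (ε n) (φ s) ∈ φ '' Icc 0 1)
    {s₀ : ℝ} (hs₀ : s₀ ∈ Ioo (0 : ℝ) 1) (hv : fld X (φ s₀) ≠ 0) : HasOrbitSubarc φ := by
  obtain ⟨ρ, hρ, R, hR, ζ, hbox⟩ := exists_isFlowBox X (φ s₀) hv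
  have hRinj : InjOn (fun t => flow X t (φ s₀)) (Icc (-R) R) := by
    have := hbox.injOn X (mem_ball_self hρ) 0 (by simpa using hR)
    simpa using this
  -- Halving ensures that parameters within `δ` of `s₀` lie in `[δ, 1 - δ]`, where `hshift` applies.
  set δ := min s₀ (1 - s₀) / 2 with hδdef
  have hm0 : 0 < min s₀ (1 - s₀) := lt_min hs₀.1 (by linarith [hs₀.2])
  have hδ : 0 < δ := by positivity
  have hδ1 : 2 * δ ≤ s₀ := by rw [hδdef]; linarith [min_le_left s₀ (1 - s₀)]
  have hδ2 : 2 * δ ≤ 1 - s₀ := by rw [hδdef]; linarith [min_le_right s₀ (1 - s₀)]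
  have hs₀I : s₀ ∈ Icc (0 : ℝ) 1 := ⟨hs₀.1.le, hs₀.2.le⟩
  obtain ⟨μ, hμ, hμφ⟩ := exists_norm_sub_ge hφ.continuousOn hinj hδ
  have hcont : Continuous fun q : AffField × ℝ => flow q.1 q.2 (φ s₀) :=
    continuous_flow.comp (f := fun q : AffField × ℝ => (q.1, q.2, φ s₀)) (by fun_prop)
  have hev : ∀ᶠ q : AffField × ℝ in 𝓝 (X, 0), flow q.1 q.2 (φ s₀) ∈ ball (φ s₀) μ := by
    have := hcont.tendsto (X, 0)
    simp only [flow_zero] at this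
    exact this (ball_mem_nhds _ hμ)
  obtain ⟨r, hr, hball⟩ := Metric.eventually_nhds_iff_ball.1 hev
  set T := min (r / 2) R with hT
  have hT0 : 0 < T := by positivity
  have hnear : ∀ᶠ n in atTop, ∀ t ∈ Icc 0 T, flow (Xn n) t (φ s₀) ∈ ball (φ s₀) μ := by
    filter_upwards [hXn (ball_mem_nhds X hr)] with n hn t ht
    refine hball (Xn n, t) ?_
    rw [mem_ball, Prod.dist_eq]
    refine max_lt hn ?_
    rw [Real.dist_eq, sub_zero, abs_of_nonneg ht.1]
    linarith [ht.2, min_le_left (r / 2) R]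
  -- Up to total time `T` the iterates stay within `μ` of `φ s₀`, hence in the middle part of the
  -- arc, so that another step is possible.
  have hit : ∀ᶠ n in atTop, ∀ k : ℕ, k * ε n ≤ T → flow (Xn n) (k * ε n) (φ s₀) ∈ φ '' Icc 0 1 := by
    filter_upwards [hnear, hshift δ hδ (by linarith)] with n hn hsn k
    induction k with
    | zero => intro _; simpa using mem_image_of_mem φ hs₀I
    | succ k ih =>
      intro hk
      have hεn := hε n
      have hk' : (k : ℝ) * ε n ≤ T := by
        push_cast at hk; nlinarith
      obtain ⟨s, hs, hse⟩ := ih hk'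
      have hb := hn (k * ε n) ⟨by positivity, hk'⟩
      have hsδ : |s - s₀| < δ := by
        by_contra hcon
        have := hμφ s hs s₀ hs₀I (not_lt.1 hcon)
        rw [mem_ball, dist_eq_norm, ← hse] at hb
        linarith
      rw [abs_lt] at hsδ
      have := hsn s ⟨by linarith, by linarith⟩
      rw [hse, ← flow_add] at this
      convert this using 2
      push_cast; ring
  -- Every time `t` is a limit of multiples of `ε n`, and the arc is closed.
  have hmem : ∀ t ∈ Icc 0 T, flow X t (φ s₀) ∈ φ '' Icc 0 1 := by
    intro t ht
    have hcl : IsClosed (φ '' Icc 0 1) := (isCompact_Icc.image hφ).isClosed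
    set K : ℕ → ℕ := fun n => ⌊t / ε n⌋₊ with hK
    have hK1 : ∀ n, (K n : ℝ) * ε n ≤ t := fun n => by
      have := Nat.floor_le (div_nonneg ht.1 (hε n).le)
      rwa [le_div_iff₀ (hε n)] at this
    have hK2 : ∀ n, t - ε n ≤ K n * ε n := fun n => by
      have := (Nat.lt_floor_add_one (t / ε n)).le
      rw [div_le_iff₀ (hε n)] at this
      simp only [hK]
      linarith
    have hKt : Tendsto (fun n => (K n : ℝ) * ε n) atTop (𝓝 t) := by
      refine tendsto_of_tendsto_of_tendsto_of_le_of_le (g := fun n => t - ε n) ?_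
        tendsto_const_nhds hK2 hK1
      simpa using tendsto_const_nhds.sub hε0
    have hlim : Tendsto (fun n => flow (Xn n) (K n * ε n) (φ s₀)) atTop (𝓝 (flow X t (φ s₀))) :=
      hcont.tendsto (X, t) |>.comp (f := fun n => (Xn n, K n * ε n)) (hXn.prodMk_nhds hKt)
    refine hcl.mem_of_tendsto hlim ?_
    filter_upwards [hit] with n hn
    exact hn (K n) ((hK1 n).trans ht.2)
  have hTR : Icc 0 T ⊆ Icc (-R) R := Icc_subset_Icc (by linarith) (min_le_right _ _)
  obtain ⟨h, hc, hmaps, heq⟩ := exists_lift_arc hφ.continuousOn hinj (T := Icc 0 T)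
    (e := fun t => flow X t (φ s₀))
    (fun t _ => (hasDerivAt_flow X (φ s₀) t).continuousAt.continuousWithinAt) hmem
  have hI := injOn_of_lift (hRinj.mono hTR) heq
  have himg := image_Icc_eq_uIcc hT0.le hc hI
  have h0T : h 0 ≠ h T := fun e =>
    hT0.ne (hI ⟨le_rfl, hT0.le⟩ ⟨hT0.le, le_rfl⟩ e)
  have hh0 := hmaps ⟨le_rfl, hT0.le⟩
  have hhT := hmaps ⟨hT0.le, le_rfl⟩
  refine ⟨X, φ s₀, R, min (h 0) (h T), max (h 0) (h T), le_min hh0.1 hhT.1, min_lt_max.2 h0T,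
    max_le hh0.2 hhT.2, hRinj, ?_⟩
  change φ '' uIcc (h 0) (h T) ⊆ _
  rw [← himg]
  rintro _ ⟨_, ⟨t, ht, rfl⟩, rfl⟩
  exact ⟨t, hTR ht, (heq t ht).symm⟩


/-! ### The fold case. -/

/-- A continuous injective function on the unit interval moves interior points to interior points. -/
lemma mem_Ioo_of_injOn {h : ℝ → ℝ} (hc : ContinuousOn h (Icc 0 1)) (hi : InjOn h (Icc 0 1))
    (hm : MapsTo h (Icc 0 1) (Icc 0 1)) {s : ℝ} (hs : s ∈ Ioo (0 : ℝ) 1) : h s ∈ Ioo (0 : ℝ) 1 := by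
  have h0 : (0 : ℝ) ∈ Icc (0 : ℝ) 1 := ⟨le_rfl, zero_le_one⟩
  have h1 : (1 : ℝ) ∈ Icc (0 : ℝ) 1 := ⟨zero_le_one, le_rfl⟩
  have hs' := Ioo_subset_Icc_self hs
  rcases hc.strictMonoOn_of_injOn_Icc' zero_le_one hi with m | m
  · exact ⟨(hm h0).1.trans_lt (m h0 hs' hs.1), (m hs' h1 hs.2).trans_le (hm h1).2⟩
  · exact ⟨(hm h1).1.trans_lt (m hs' h1 hs.2), (m h0 hs' hs.1).trans_le (hm h0).2⟩

/-- By `SubarcPair.mem_of_mem`, one middle point landing in the arc would bring `φ (1/2)` there too.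
-/
lemma eventually_forall_notMem {φ : ℝ → ℂ} (hφ : Continuous φ) (hinj : InjOn φ (Icc 0 1))
    {i j f : ℕ → ℂ ≃ᵃ[ℝ] ℂ} (hi : ∀ n, MapsTo (i n) (φ '' Icc 0 1) (φ '' Icc 0 1))
    (hj : ∀ n, MapsTo (j n) (φ '' Icc 0 1) (φ '' Icc 0 1)) (hf : ∀ n z, j n (f n z) = i n z)
    (hclose : ∀ η > 0, ∀ᶠ n in atTop, ∀ s ∈ Icc (0 : ℝ) 1, ‖f n (φ s) - φ s‖ < η)
    (hout : ∀ᶠ n in atTop, f n (φ (1 / 2)) ∉ φ '' Icc 0 1) {δ : ℝ} (hδ : 0 < δ) (hδ2 : δ ≤ 1 / 2) :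
    ∀ᶠ n in atTop, ∀ s ∈ Icc δ (1 - δ), f n (φ s) ∉ φ '' Icc 0 1 := by
  obtain ⟨η, hη, hηφ⟩ := exists_norm_sub_ge hφ.continuousOn hinj hδ
  filter_upwards [hclose η hη, hout] with n hn ho s hs hmem
  obtain ⟨h, k, P⟩ := SubarcPair.exists_of_mapsTo hφ hinj (hi n) (hj n) (hf n)
  exact ho (P.mem_of_mem hδ.le hηφ hn hs ⟨hδ2, by linarith⟩ hmem)

/-- Flow maps moving an arc off itself exclude that two oppositely oriented subarcs both cross flow
lines in the same direction. -/
lemma false_of_subarcPair {φ : ℝ → ℂ} (hφ : Continuous φ) {i j f : ℂ ≃ᵃ[ℝ] ℂ} {h k : ℝ → ℝ}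
    (P : SubarcPair φ i j f h k) {Xm : ℕ → AffField} {X : AffField} (hXm : Tendsto Xm atTop (𝓝 X))
    {ε : ℕ → ℝ} (hε : ∀ m, 0 < ε m) (hε0 : Tendsto ε atTop (𝓝 0))
    (hoff : ∀ δ > 0, δ ≤ 1 / 2 → ∀ᶠ m in atTop, ∀ s ∈ Icc δ (1 - δ),
      flow (Xm m) (ε m) (φ s) ∉ φ '' Icc 0 1)
    {X' : AffField} {p : ℂ} {ρ R : ℝ} {ζ : AffField → ℂ → ℂ} (hbox : IsFlowBox X' p ρ R ζ)
    (hρ : 0 < ρ) (hv : fld X' p ≠ 0) {c : ℝ} (hc : 0 < c) (hX : c • pull j X ∈ ball X' ρ)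
    {s₀ s₁ : ℝ} (hs₀ : s₀ ∈ Ioo (0 : ℝ) 1) (hs₁ : s₁ ∈ Ioo (0 : ℝ) 1)
    (hopp : (h s₀ < h s₁ ∧ k s₁ < k s₀) ∨ (h s₁ < h s₀ ∧ k s₀ < k s₁))
    (hB : ∀ s ∈ uIcc s₀ s₁, φ s ∈ ball p ρ) (hfB : ∀ s ∈ uIcc s₀ s₁, f (φ s) ∈ ball p ρ)
    (hu : (ζ (c • pull j X) (φ s₀)).im < (ζ (c • pull j X) (φ s₁)).im)
    (hfu : (ζ (c • pull j X) (f (φ s₀))).im < (ζ (c • pull j X) (f (φ s₁))).im) : False := by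
  -- The enlarged arc `j⁻¹ γ` contains `φ` as `ψ ∘ k` and `f ∘ φ` as `ψ ∘ h`.
  set ψ : ℝ → ℂ := fun r => j.symm (φ r) with hψ
  have hψc : Continuous ψ := (continuous_affine j.symm).comp hφ
  have hJ : uIcc s₀ s₁ ⊆ Icc (0 : ℝ) 1 :=
    uIcc_subset_Icc (Ioo_subset_Icc_self hs₀) (Ioo_subset_Icc_self hs₁)
  have hψk : ∀ s ∈ Icc (0 : ℝ) 1, ψ (k s) = φ s := fun s hs => by
    simp only [hψ]; rw [P.eqR s hs, AffineEquiv.symm_apply_apply]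
  have hψh : ∀ s ∈ Icc (0 : ℝ) 1, ψ (h s) = f (φ s) := fun s hs => by
    simp only [hψ]; rw [P.eqL s hs, ← P.conj, AffineEquiv.symm_apply_apply]
  have hIk : ∀ r ∈ uIcc (k s₀) (k s₁), ψ r ∈ ball p ρ := fun r hr => by
    obtain ⟨s, hs, rfl⟩ := intermediate_value_uIcc (P.contR.mono hJ) hr
    rw [hψk s (hJ hs)]; exact hB s hs
  have hIh : ∀ r ∈ uIcc (h s₀) (h s₁), ψ r ∈ ball p ρ := fun r hr => by
    obtain ⟨s, hs, rfl⟩ := intermediate_value_uIcc (P.contL.mono hJ) hr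
    rw [hψh s (hJ hs)]; exact hfB s hs
  have m1 := mem_Ioo_of_injOn P.contL P.injOnL P.mapsL hs₀
  have m2 := mem_Ioo_of_injOn P.contL P.injOnL P.mapsL hs₁
  have m3 := mem_Ioo_of_injOn P.contR P.injOnR P.mapsR hs₀
  have m4 := mem_Ioo_of_injOn P.contR P.injOnR P.mapsR hs₁
  have hδ : ∀ {x : ℝ}, x ∈ Ioo (0 : ℝ) 1 → ∃ δ > 0, δ ≤ x ∧ x ≤ 1 - δ := fun {x} hx =>
    ⟨min x (1 - x), lt_min hx.1 (by linarith [hx.2]), min_le_left _ _,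
      by linarith [min_le_right x (1 - x)]⟩
  obtain ⟨δ, hδ0, hδ2, n1, n2, n3, n4⟩ : ∃ δ > 0, δ ≤ 1 / 2 ∧ h s₀ ∈ Icc δ (1 - δ) ∧
      h s₁ ∈ Icc δ (1 - δ) ∧ k s₀ ∈ Icc δ (1 - δ) ∧ k s₁ ∈ Icc δ (1 - δ) := by
    obtain ⟨d1, p1, q1, r1⟩ := hδ m1
    obtain ⟨d2, p2, q2, r2⟩ := hδ m2
    obtain ⟨d3, p3, q3, r3⟩ := hδ m3
    obtain ⟨d4, p4, q4, r4⟩ := hδ m4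
    set d := min (min d1 d2) (min d3 d4) with hd
    have e1 : d ≤ d1 := (min_le_left _ _).trans (min_le_left _ _)
    have e2 : d ≤ d2 := (min_le_left _ _).trans (min_le_right _ _)
    have e3 : d ≤ d3 := (min_le_right _ _).trans (min_le_left _ _)
    have e4 : d ≤ d4 := (min_le_right _ _).trans (min_le_right _ _)
    exact ⟨d, lt_min (lt_min p1 p2) (lt_min p3 p4), by linarith, ⟨by linarith, by linarith⟩,
      ⟨by linarith, by linarith⟩, ⟨by linarith, by linarith⟩, ⟨by linarith, by linarith⟩⟩
  have hsub : Icc δ (1 - δ) ⊆ Icc (0 : ℝ) 1 := Icc_subset_Icc hδ0.le (by linarith)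
  have hcross : ∀ᶠ m in atTop, ∀ s ∈ Icc δ (1 - δ), ∀ t ∈ Icc δ (1 - δ),
      flow (c • pull j (Xm m)) (ε m / c) (ψ s) ≠ ψ t := by
    filter_upwards [hoff δ hδ0 hδ2] with m hm s hs t ht e
    apply hm s hs
    rw [flow_smul, div_mul_cancel₀ _ hc.ne'] at e
    refine ⟨t, hsub ht, ?_⟩
    have e2 := apply_flow_pull j (Xm m) (ε m) (ψ s)
    rw [e] at e2
    simpa [hψ] using e2
  have hlim : Tendsto (fun m => c • pull j (Xm m)) atTop (𝓝 (c • pull j X)) :=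
    (((continuous_pull j).tendsto X).comp hXm).const_smul c
  have hε' : Tendsto (fun m => ε m / c) atTop (𝓝 0) := by simpa using hε0.div_const c
  have hεp : ∀ m, 0 < ε m / c := fun m => div_pos (hε m) hc
  have hinjψ : InjOn ψ (Icc δ (1 - δ)) := fun x hx y hy e =>
    P.inj (hsub hx) (hsub hy) (j.symm.injective e)
  have c0 := Ioo_subset_Icc_self hs₀
  have c1 := Ioo_subset_Icc_self hs₁
  rw [← hψk s₀ c0, ← hψk s₁ c1] at hu
  rw [← hψh s₀ c0, ← hψh s₁ c1] at hfu
  -- Both pieces climb from `s₀` to `s₁`, but `ψ` runs through them in opposite directions.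
  rcases hopp with ⟨o1, o2⟩ | ⟨o1, o2⟩
  · exact false_of_opposite_crossing hbox hρ hv hbox hρ hv hX hX hlim hεp hε' hψc.continuousOn
      hinjψ hcross n1 n2 n3 n4 o1 o2 hIh hIk hfu hu
  · exact false_of_opposite_crossing hbox hρ hv hbox hρ hv hX hX hlim hεp hε' hψc.continuousOn
      hinjψ hcross n3 n4 n1 n2 o2 o1 hIk hIh hu hfu

/-- The pulled-back fields need not be bounded or stay away from 0; scaled to the unit sphere they
have a nonzero limit point. -/
lemma exists_subseq_pull {X : AffField} (hX : X ≠ 0) (j : ℕ → ℂ ≃ᵃ[ℝ] ℂ) :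
    ∃ (c : ℕ → ℝ) (X' : AffField) (κ : ℕ → ℕ), (∀ n, 0 < c n) ∧ X' ≠ 0 ∧ StrictMono κ ∧
      Tendsto (fun n => c n • pull (j (κ n)) X) atTop (𝓝 X') := by
  have hsph : ∀ n, ‖pull (j n) X‖⁻¹ • pull (j n) X ∈ sphere (0 : AffField) 1 := by
    intro n
    rw [mem_sphere_zero_iff_norm, norm_smul, norm_inv, norm_norm,
      inv_mul_cancel₀ (norm_ne_zero_iff.2 (pull_ne_zero (j n) hX))]
  have : ProperSpace AffField := FiniteDimensional.proper_real AffField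
  obtain ⟨X', hX', κ, hκ, hlim⟩ := (isCompact_sphere (0 : AffField) 1).tendsto_subseq hsph
  refine ⟨fun n => ‖pull (j (κ n)) X‖⁻¹, X', κ,
    fun n => inv_pos.2 (norm_pos_iff.2 (pull_ne_zero _ hX)), ?_, hκ, hlim⟩
  rintro rfl
  simp at hX'

/-- If small flow maps move an arc partially off itself and the arc is folded by the corresponding
pairs of affine maps, the arc contains a piece of a flow line. -/
lemma hasOrbitSubarc_of_fold {φ : ℝ → ℂ} (hφ : Continuous φ) (hinj : InjOn φ (Icc 0 1))
    (hl : ¬ InLine (φ '' Icc 0 1))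
    {i j f : ℕ → ℂ ≃ᵃ[ℝ] ℂ} (hi : ∀ n, MapsTo (i n) (φ '' Icc 0 1) (φ '' Icc 0 1))
    (hj : ∀ n, MapsTo (j n) (φ '' Icc 0 1) (φ '' Icc 0 1)) (hf : ∀ n z, j n (f n z) = i n z)
    {Xn : ℕ → AffField} {X : AffField} (hX : X ≠ 0) (hXn : Tendsto Xn atTop (𝓝 X)) {ε : ℕ → ℝ}
    (hε : ∀ n, 0 < ε n) (hε0 : Tendsto ε atTop (𝓝 0))
    (hflow : ∀ n z, f n z = flow (Xn n) (ε n) z)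
    (hout : ∀ᶠ n in atTop, f n (φ (1 / 2)) ∉ φ '' Icc 0 1)
    (hmeet : ∀ n, ∃ s ∈ Icc (0 : ℝ) 1, f n (φ s) ∈ φ '' Icc 0 1) : HasOrbitSubarc φ := by
  have hγ : IsCompact (φ '' Icc 0 1) := isCompact_Icc.image hφ
  have hclose : ∀ η > 0, ∀ᶠ n in atTop, ∀ s ∈ Icc (0 : ℝ) 1, ‖f n (φ s) - φ s‖ < η := by
    intro η hη
    filter_upwards [eventually_norm_flow_sub_lt hXn hε0 hγ hη] with n hn s hs
    rw [hflow]
    exact hn _ (mem_image_of_mem _ hs)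
  have hoff : ∀ δ > 0, δ ≤ 1 / 2 → ∀ᶠ m in atTop, ∀ s ∈ Icc δ (1 - δ),
      flow (Xn m) (ε m) (φ s) ∉ φ '' Icc 0 1 := by
    intro δ hδ hδ2
    simpa only [hflow] using eventually_forall_notMem hφ hinj hi hj hf hclose hout hδ hδ2
  obtain ⟨c, X', κ, hc, hX', hκ, hlim⟩ := exists_subseq_pull hX j
  obtain ⟨σ, hσ, hv⟩ := exists_fld_ne_zero hX' hφ hl
  obtain ⟨ρ, hρ, R, hR, ζ, hbox⟩ := exists_isFlowBox X' (φ σ) hv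
  obtain ⟨d, hd, hdφ⟩ := Metric.continuousAt_iff.1 (hφ.continuousAt (x := σ)) (ρ / 2) (by positivity)
  obtain ⟨a, b, hab, hJ01, hJφ⟩ : ∃ a b, a < b ∧ Icc a b ⊆ Ioo (0 : ℝ) 1 ∧
      ∀ s ∈ Icc a b, φ s ∈ ball (φ σ) (ρ / 2) := by
    set e := min d (min σ (1 - σ)) / 2
    have he : 0 < min d (min σ (1 - σ)) := lt_min hd (lt_min hσ.1 (by linarith [hσ.2]))
    have e1 : 2 * e ≤ d := by simp only [e]; linarith [min_le_left d (min σ (1 - σ))]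
    have e2 : 2 * e ≤ σ := by
      simp only [e]; linarith [min_le_right d (min σ (1 - σ)), min_le_left σ (1 - σ)]
    have e3 : 2 * e ≤ 1 - σ := by
      simp only [e]; linarith [min_le_right d (min σ (1 - σ)), min_le_right σ (1 - σ)]
    have e0 : 0 < e := by simp only [e]; linarith
    refine ⟨σ - e, σ + e, by linarith, fun s hs => ⟨by linarith [hs.1], by linarith [hs.2]⟩,
      fun s hs => hdφ ?_⟩
    rw [Real.dist_eq, abs_lt]
    exact ⟨by linarith [hs.1], by linarith [hs.2]⟩
  have hhalf : ball (φ σ) (ρ / 2) ⊆ ball (φ σ) ρ := ball_subset_ball (by linarith)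
  have hball : ∀ s ∈ Icc a b, φ s ∈ ball (φ σ) ρ := fun s hs => hhalf (hJφ s hs)
  -- By symmetry this makes the transversal coordinate constant. A strict rise would persist for
  -- some large `n`, along both `φ` and `f (κ n) ∘ φ`, for the field `c n • pull (j (κ n)) X`. With
  -- that `n` fixed, `false_of_subarcPair` uses the flow maps of all large indices `m`.
  have hle : ∀ s₀ ∈ Icc a b, ∀ s₁ ∈ Icc a b, (ζ X' (φ s₁)).im ≤ (ζ X' (φ s₀)).im := by
    intro s₀ hs₀ s₁ hs₁
    by_contra! hlt
    have hU : uIcc s₀ s₁ ⊆ Icc a b := uIcc_subset_Icc hs₀ hs₁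
    have hne : s₀ ≠ s₁ := by rintro rfl; exact lt_irrefl _ hlt
    obtain ⟨η, hη, hηφ⟩ := exists_norm_sub_ge hφ.continuousOn hinj (show (0 : ℝ) < 1 / 2 by norm_num)
    have key : ∀ s ∈ Icc a b, ∀ w : ℕ → ℂ, Tendsto w atTop (𝓝 (φ s)) →
        Tendsto (fun n => (ζ (c n • pull (j (κ n)) X) (w n)).im) atTop (𝓝 (ζ X' (φ s)).im) := by
      intro s hs w hw
      have h1 : ContinuousAt (fun q : AffField × ℂ => ζ q.1 q.2) (X', φ s) :=
        hbox.continuousOn.continuousAt (prod_mem_nhds (ball_mem_nhds _ hρ)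
          (isOpen_ball.mem_nhds (hball s hs)))
      have h2 := h1.tendsto.comp (hlim.prodMk_nhds hw)
      exact (Complex.continuous_im.tendsto _).comp h2
    have hfw : ∀ s ∈ Icc a b, Tendsto (fun n => f (κ n) (φ s)) atTop (𝓝 (φ s)) := by
      intro s hs
      have h1 : Tendsto (fun n => f n (φ s)) atTop (𝓝 (φ s)) := by
        rw [Metric.tendsto_nhds]
        intro e he
        filter_upwards [hclose e he] with n hn
        rw [dist_eq_norm]
        exact hn s (Ioo_subset_Icc_self (hJ01 hs))
      exact h1.comp hκ.tendsto_atTop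
    have E1 := (key s₀ hs₀ _ tendsto_const_nhds).eventually_lt (key s₁ hs₁ _ tendsto_const_nhds) hlt
    have E2 := (key s₀ hs₀ _ (hfw s₀ hs₀)).eventually_lt (key s₁ hs₁ _ (hfw s₁ hs₁)) hlt
    have E3 := hκ.tendsto_atTop.eventually
      ((hclose η hη).and ((hclose (ρ / 2) (by positivity)).and hout))
    obtain ⟨n, ⟨⟨h1, h2⟩, h3, h4, h5⟩, h6⟩ :=
      ((E1.and E2).and E3 |>.and (hlim (ball_mem_nhds X' hρ))).exists
    obtain ⟨h, k, P⟩ := SubarcPair.exists_of_mapsTo hφ hinj (hi (κ n)) (hj (κ n)) (hf (κ n))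
    refine false_of_subarcPair hφ P hXn hε hε0 hoff hbox hρ hv (hc n) h6 (hJ01 hs₀) (hJ01 hs₁)
      (P.opposite hηφ h3 h5 (hmeet _) (Ioo_subset_Icc_self (hJ01 hs₀))
        (Ioo_subset_Icc_self (hJ01 hs₁)) hne)
      (fun s hs => hball s (hU hs)) (fun s hs => ?_) h1 h2
    have g1 := h4 s (Ioo_subset_Icc_self (hJ01 (hU hs)))
    have g2 := hJφ s (hU hs)
    rw [mem_ball, dist_eq_norm] at g2 ⊢
    calc ‖f (κ n) (φ s) - φ σ‖ ≤ ‖f (κ n) (φ s) - φ s‖ + ‖φ s - φ σ‖ := norm_sub_le_norm_sub_add_norm_sub ..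
      _ < ρ := by linarith
  have ha : a ∈ Icc a b := left_mem_Icc.2 hab.le
  have hX'b : X' ∈ ball X' ρ := mem_ball_self hρ
  refine ⟨X', _, R, a, b, (hJ01 ha).1.le, hab, (hJ01 (right_mem_Icc.2 hab.le)).2.le,
    hbox.injOn X' hX'b (ζ X' (φ a)).im
      ((Complex.abs_im_le_norm _).trans_lt (hbox.norm_lt X' hX'b _ (hball a ha))), ?_⟩
  rintro _ ⟨s, hs, rfl⟩
  refine ⟨(ζ X' (φ s)).re, ?_, ?_⟩
  · have := (Complex.abs_re_le_norm _).trans (hbox.norm_lt X' hX'b _ (hball s hs)).le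
    rwa [abs_le] at this
  · have e : (ζ X' (φ a)).im = (ζ X' (φ s)).im := le_antisymm (hle s hs a ha) (hle a ha s hs)
    simp only [e]
    exact (hbox.eq_flow X' hX'b _ (hball s hs)).symm

/-- The local structure of the arc. -/
theorem inLine_or_hasOrbitSubarc {φ : ℝ → ℂ} (hφ : Continuous φ) (hinj : InjOn φ (Icc 0 1))
    {i j f : ℕ → ℂ ≃ᵃ[ℝ] ℂ} (hi : ∀ n, MapsTo (i n) (φ '' Icc 0 1) (φ '' Icc 0 1))
    (hj : ∀ n, MapsTo (j n) (φ '' Icc 0 1) (φ '' Icc 0 1)) (hf : ∀ n z, j n (f n z) = i n z)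
    (hne : ∀ n, f n ≠ 1) (hlim : ∀ z, Tendsto (fun n => f n z) atTop (𝓝 z))
    (hmeet : ∀ n, ∃ s ∈ Icc (0 : ℝ) 1, f n (φ s) ∈ φ '' Icc 0 1) :
    InLine (φ '' Icc 0 1) ∨ HasOrbitSubarc φ := by
  by_cases hl : InLine (φ '' Icc 0 1)
  · exact Or.inl hl
  right
  obtain ⟨θ, hθ, Xn, X, ε, hX, hε, hε0, hXn, hflow⟩ := exists_generators hne hlim
  by_cases hfr : ∃ᶠ n in atTop, f (θ n) (φ (1 / 2)) ∈ φ '' Icc 0 1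
  · obtain ⟨τ, hτ, hmem⟩ := extraction_of_frequently_atTop hfr
    obtain ⟨s, hs, hv⟩ := exists_fld_ne_zero hX hφ hl
    refine hasOrbitSubarc_of_shift hφ hinj (hXn.comp hτ.tendsto_atTop) (fun n => hε (τ n))
      (hε0.comp hτ.tendsto_atTop) (fun δ hδ hδ2 => ?_) hs hv
    obtain ⟨η, hη, hηφ⟩ := exists_norm_sub_ge hφ.continuousOn hinj hδ
    filter_upwards [hτ.tendsto_atTop.eventually
      (eventually_norm_flow_sub_lt hXn hε0 (isCompact_Icc.image hφ) hη)] with n hn s hs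
    obtain ⟨h, k, P⟩ := SubarcPair.exists_of_mapsTo hφ hinj (hi (θ (τ n))) (hj (θ (τ n)))
      (hf (θ (τ n)))
    have := P.mem_of_mem hδ.le hηφ (fun s hs => by
      rw [hflow]; exact hn _ (mem_image_of_mem _ hs)) (s₀ := 1 / 2) ⟨hδ2.le, by linarith⟩ hs (hmem n)
    rwa [hflow] at this
  · exact hasOrbitSubarc_of_fold hφ hinj hl (fun n => hi (θ n)) (fun n => hj (θ n))
      (fun n => hf (θ n)) hX hXn hε hε0 hflow (not_frequently.1 hfr) (fun n => hmeet _)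


/-! ### From a piece of a flow line to the whole arc. -/

/-- An arc containing a piece of a flow line, and having small affine copies of itself everywhere,
is a piece of a flow line. -/
lemma exists_eq_orbit {φ : ℝ → ℂ} (hφ : Continuous φ) (hinj : InjOn φ (Icc 0 1))
    (hself : ∀ p ∈ φ '' Icc 0 1, ∀ ε > 0,
      ∃ g : ℂ ≃ᵃ[ℝ] ℂ, g '' (φ '' Icc 0 1) ⊆ φ '' Icc 0 1 ∩ ball p ε)
    (horb : HasOrbitSubarc φ) :
    ∃ (X : AffField) (q : ℂ) (α β : ℝ), α < β ∧ InjOn (fun t => flow X t q) (Icc α β) ∧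
      φ '' Icc 0 1 = (fun t => flow X t q) '' Icc α β := by
  obtain ⟨X, q, r, a, b, ha, hab, hb, hΓ, hsub⟩ := horb
  have hmid : (a + b) / 2 ∈ Icc (0 : ℝ) 1 := ⟨by linarith, by linarith⟩
  -- A copy of the arc within `μ` of `φ ((a + b) / 2)` has all its parameters in `[a, b]`, hence
  -- lies on the flow line; `g⁻¹` carries this back to the whole arc.
  obtain ⟨μ, hμ, hμφ⟩ := exists_norm_sub_ge hφ.continuousOn hinj
    (show 0 < (b - a) / 2 by linarith)
  obtain ⟨g, hg⟩ := hself _ (mem_image_of_mem φ hmid) μ hμ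
  have hflow : ∀ t, flow (pull g X) t (g.symm q) = g.symm (flow X t q) := fun t => by
    have := apply_flow_pull g X t (g.symm q)
    rw [AffineEquiv.apply_symm_apply] at this
    rw [← this, AffineEquiv.symm_apply_apply]
  have hΓ' : InjOn (fun t => flow (pull g X) t (g.symm q)) (Icc (-r) r) := by
    intro s hs t ht e
    simp only [hflow] at e
    exact hΓ hs ht (g.symm.injective e)
  have hmaps : MapsTo φ (Icc 0 1) ((fun t => flow (pull g X) t (g.symm q)) '' Icc (-r) r) := by
    intro s hs
    obtain ⟨⟨s', hs', e⟩, h2⟩ := hg (mem_image_of_mem g (mem_image_of_mem φ hs))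
    have h3 : |s' - (a + b) / 2| < (b - a) / 2 := by
      by_contra! hcon
      have := hμφ s' hs' _ hmid hcon
      rw [mem_ball, dist_eq_norm, ← e] at h2
      linarith
    rw [abs_lt] at h3
    obtain ⟨t, ht, e2⟩ := hsub (mem_image_of_mem φ (show s' ∈ Icc a b from
      ⟨by linarith, by linarith⟩))
    refine ⟨t, ht, ?_⟩
    simp only [hflow] at e2 ⊢
    rw [e2, e, AffineEquiv.symm_apply_apply]
  obtain ⟨h, hc, hm, he⟩ := exists_lift_arc (fun t _ =>
    (hasDerivAt_flow (pull g X) (g.symm q) t).continuousAt.continuousWithinAt) hΓ'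
    hφ.continuousOn hmaps
  have hi := injOn_of_lift (c := fun t => flow (pull g X) t (g.symm q)) hinj he
  have himg := image_Icc_eq_uIcc zero_le_one hc hi
  have h0 : (0 : ℝ) ∈ Icc (0 : ℝ) 1 := ⟨le_rfl, zero_le_one⟩
  have h1 : (1 : ℝ) ∈ Icc (0 : ℝ) 1 := ⟨zero_le_one, le_rfl⟩
  have hne : h 0 ≠ h 1 := fun e => zero_ne_one (hi h0 h1 e)
  refine ⟨pull g X, g.symm q, min (h 0) (h 1), max (h 0) (h 1), min_lt_max.2 hne,
    hΓ'.mono (uIcc_subset_Icc (hm h0) (hm h1)), ?_⟩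
  change _ = _ '' uIcc (h 0) (h 1)
  rw [← himg, ← image_comp]
  exact image_congr fun s hs => (he s hs).symm

/-! ### Affinely self-similar flow lines. -/

/-- The area form on the plane. -/
def cross (z w : ℂ) : ℝ := z.re * w.im - z.im * w.re

lemma cross_self (z : ℂ) : cross z z = 0 := by unfold cross; ring

lemma cross_add_right (z u w : ℂ) : cross z (u + w) = cross z u + cross z w := by
  simp only [cross, Complex.add_re, Complex.add_im]; ring

lemma cross_smul_right (c : ℝ) (z w : ℂ) : cross z (c • w) = c * cross z w := by
  simp only [cross, Complex.smul_re, Complex.smul_im, smul_eq_mul]; ring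

lemma cross_add_left (u w z : ℂ) : cross (u + w) z = cross u z + cross w z := by
  simp only [cross, Complex.add_re, Complex.add_im]; ring

lemma cross_smul_left (c : ℝ) (z w : ℂ) : cross (c • z) w = c * cross z w := by
  simp only [cross, Complex.smul_re, Complex.smul_im, smul_eq_mul]; ring

lemma cross_swap (z w : ℂ) : cross z w = -cross w z := by unfold cross; ring

lemma _root_.HasDerivAt.cross {a b : ℝ → ℂ} {a' b' : ℂ} {t : ℝ} (ha : HasDerivAt a a' t)
    (hb : HasDerivAt b b' t) :
    HasDerivAt (fun s => cross (a s) (b s)) (cross a' (b t) + cross (a t) b') t := by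
  have hre : ∀ {c : ℝ → ℂ} {c'}, HasDerivAt c c' t → HasDerivAt (fun s => (c s).re) c'.re t :=
    fun h => Complex.reCLM.hasFDerivAt.comp_hasDerivAt t h
  have him : ∀ {c : ℝ → ℂ} {c'}, HasDerivAt c c' t → HasDerivAt (fun s => (c s).im) c'.im t :=
    fun h => Complex.imCLM.hasFDerivAt.comp_hasDerivAt t h
  refine (((hre ha).mul (him hb)).sub ((him ha).mul (hre hb))).congr_deriv ?_
  unfold AffField.cross; ring

lemma linearIndependent_of_cross {u v : ℂ} (h : cross u v ≠ 0) : LinearIndependent ℝ ![u, v] := by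
  rw [LinearIndependent.pair_iff]
  intro s t e
  have h1 := congrArg (cross u) e
  have h2 := congrArg (cross v) e
  rw [cross_add_right, cross_smul_right, cross_smul_right, cross_self] at h1 h2
  rw [cross_swap v u] at h2
  have h0 : ∀ z, cross z 0 = 0 := fun z => by simp [cross]
  rw [h0] at h1 h2
  constructor
  · have : s * cross u v = 0 := by linarith
    exact (mul_eq_zero.1 this).resolve_right h
  · have : t * cross u v = 0 := by linarith
    exact (mul_eq_zero.1 this).resolve_right h

/-- The witnesses are the trace and the determinant in the basis `1, I`. -/
lemma exists_cayleyHamilton (A : ℂ →L[ℝ] ℂ) : ∃ τ δ : ℝ, ∀ z, A (A z) = τ • A z - δ • z := by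
  have hA : ∀ z, A z = z.re • A 1 + z.im • A Complex.I := fun z => by
    rw [← map_smul, ← map_smul, ← map_add]
    congr 1
    apply Complex.ext <;> simp
  refine ⟨(A 1).re + (A Complex.I).im, (A 1).re * (A Complex.I).im - (A 1).im * (A Complex.I).re,
    fun z => ?_⟩
  rw [hA (A z), hA z]
  apply Complex.ext <;> simp <;> ring

lemma eq_mul_exp_of_hasDerivAt {y : ℝ → ℝ} {μ : ℝ} (h : ∀ t, HasDerivAt y (μ * y t) t) (t : ℝ) :
    y t = y 0 * Real.exp (μ * t) := by
  have h1 : ∀ t, HasDerivAt (fun t => y t * Real.exp (-(μ * t))) 0 t := fun t => by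
    have h2 : HasDerivAt (fun t => Real.exp (-(μ * t))) (Real.exp (-(μ * t)) * -(μ * 1)) t :=
      ((hasDerivAt_id t).const_mul μ).neg.exp
    refine ((h t).mul h2).congr_deriv ?_
    ring
  have h3 := is_const_of_deriv_eq_zero (fun t => (h1 t).differentiableAt) (fun t => (h1 t).deriv) t 0
  simp only [mul_zero, neg_zero, Real.exp_zero, mul_one] at h3
  rw [← h3, mul_assoc, ← Real.exp_add]
  simp

lemma hasDerivAt_fld_flow (X : AffField) (q : ℂ) (t : ℝ) :
    HasDerivAt (fun t => fld X (flow X t q)) (X.1 (fld X (flow X t q))) t :=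
  (X.1.hasFDerivAt.comp_hasDerivAt t (hasDerivAt_flow X q t)).add_const X.2

/-- Flow lines with velocity and acceleration parallel at one point are contained in a line. -/
lemma inLine_orbit {X : AffField} {q : ℂ} (hv : fld X q ≠ 0)
    (hw : cross (fld X q) (X.1 (fld X q)) = 0) (T : Set ℝ) :
    InLine ((fun t => flow X t q) '' T) := by
  set v := fld X q with hvdef
  have hn : v.re ^ 2 + v.im ^ 2 ≠ 0 := by
    intro h
    apply hv
    apply Complex.ext
    · simp only [Complex.zero_re]; nlinarith [sq_nonneg v.re, sq_nonneg v.im]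
    · simp only [Complex.zero_im]; nlinarith [sq_nonneg v.re, sq_nonneg v.im]
  have hdec : ∀ x : ℂ, x = ((v.re * x.re + v.im * x.im) / (v.re ^ 2 + v.im ^ 2)) • v +
      (cross v x / (v.re ^ 2 + v.im ^ 2)) • (Complex.I * v) := fun x => by
    apply Complex.ext
    · simp only [cross, Complex.add_re, Complex.smul_re, smul_eq_mul, Complex.mul_re, Complex.I_re,
        Complex.I_im]
      field_simp; ring
    · simp only [cross, Complex.add_im, Complex.smul_im, smul_eq_mul, Complex.mul_im, Complex.I_re,
        Complex.I_im]
      field_simp; ring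
  set μ := cross v (X.1 (Complex.I * v)) / (v.re ^ 2 + v.im ^ 2) with hμ
  -- `X.1 v` is parallel to `v`, so `cross v ∘ X.1` kills `v` and is a multiple of `cross v`. The
  -- distance from the tangent line thus solves a linear equation with initial value 0.
  have hA : ∀ x, cross v (X.1 x) = μ * cross v x := fun x => by
    conv_lhs => rw [hdec x]
    rw [map_add, map_smul, map_smul, cross_add_right, cross_smul_right, cross_smul_right, hw, hμ]
    ring
  have hm : ∀ t, HasDerivAt (fun t => cross v (flow X t q - q)) (μ * cross v (flow X t q - q)) t := by
    intro t
    refine ((hasDerivAt_const t v).cross ((hasDerivAt_flow X q t).sub_const q)).congr_deriv ?_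
    have h1 : fld X (flow X t q) = v + X.1 (flow X t q - q) := by
      simp only [hvdef, fld, map_sub]; ring
    have h0 : cross 0 (flow X t q - q) = 0 := by simp [cross]
    rw [h0, h1, cross_add_right, cross_self, hA]; ring
  refine ⟨v.re • Complex.imCLM - v.im • Complex.reCLM, ?_, cross v q, ?_⟩
  · intro h
    have h1 := DFunLike.congr_fun h (Complex.I * v)
    simp at h1
    apply hn
    linarith
  · rintro _ ⟨t, _, rfl⟩
    have h1 := eq_mul_exp_of_hasDerivAt hm t
    simp only [flow_zero, sub_self] at h1
    have h0 : cross v 0 = 0 := by simp [cross]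
    rw [h0, zero_mul] at h1
    simp [cross] at h1 ⊢
    linarith

lemma fld_ne_zero_of_injOn {X : AffField} {q : ℂ} {α β : ℝ} (hαβ : α < β)
    (hinj : InjOn (fun t => flow X t q) (Icc α β)) : fld X q ≠ 0 := by
  intro h
  have h1 : ∀ t, flow X t q = q := fun t => (eq_flow_of_hasDerivAt (c := fun _ => q) (fun t => by
    rw [h]; exact hasDerivAt_const t q) t).symm
  exact hαβ.ne (hinj (left_mem_Icc.2 hαβ.le) (right_mem_Icc.2 hαβ.le) (by simp only [h1]))

/-- Local differentiability of reparametrizations. -/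
lemma differentiableAt_of_comp {c e : ℝ → ℂ} {h : ℝ → ℝ} {t : ℝ} {c' : ℂ}
    (hc : HasStrictDerivAt c c' (h t)) (hc' : c' ≠ 0) (he : DifferentiableAt ℝ e t)
    (hh : ContinuousAt h t) (heq : ∀ᶠ s in 𝓝 t, c (h s) = e s) : DifferentiableAt ℝ h t := by
  -- The inner product with `c'`: its value at `c'` is `|c'|²`, so `l ∘ c` is locally invertible.
  set l : ℂ →L[ℝ] ℝ := c'.re • Complex.reCLM + c'.im • Complex.imCLM with hl
  have hlc : l c' ≠ 0 := by
    intro h0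
    apply hc'
    simp [hl] at h0
    apply Complex.ext
    · simp only [Complex.zero_re]; nlinarith [sq_nonneg c'.re, sq_nonneg c'.im]
    · simp only [Complex.zero_im]; nlinarith [sq_nonneg c'.re, sq_nonneg c'.im]
  have hF : HasStrictDerivAt (fun s => l (c s)) (l c') (h t) :=
    l.hasStrictFDerivAt.comp_hasStrictDerivAt (h t) hc
  set G := hF.localInverse _ _ _ hlc
  have hG : HasStrictDerivAt G (l c')⁻¹ (l (c (h t))) := hF.to_localInverse hlc
  have hGF : ∀ᶠ x in 𝓝 (h t), G (l (c x)) = x :=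
    (hF.hasStrictFDerivAt_equiv hlc).eventually_left_inverse
  have e1 : h =ᶠ[𝓝 t] fun s => G (l (e s)) := by
    filter_upwards [hh.eventually hGF, heq] with s h1 h2
    rw [← h2, h1]
  have h3 : DifferentiableAt ℝ (fun s => G (l (e s))) t := by
    have h4 : DifferentiableAt ℝ G (l (e t)) := by
      rw [← heq.self_of_nhds]; exact hG.hasDerivAt.differentiableAt
    exact h4.comp t (l.differentiableAt.comp t he)
  exact h3.congr_of_eventuallyEq e1


/-- The rate of an affine self-similarity along a nondegenerate curve `v' = A v` of velocities. -/
lemma rate_eq {A L : ℂ →L[ℝ] ℂ} (hL : ∀ z, L z = 0 → z = 0) {τ δ : ℝ}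
    (hA : ∀ z, A (A z) = τ • A z - δ • z) {v : ℝ → ℂ} (hv : ∀ t, HasDerivAt v (A (v t)) t)
    (hw : ∀ t, cross (v t) (A (v t)) ≠ 0) {h ρ : ℝ → ℝ} {U : Set ℝ} (hU : IsOpen U)
    (hh : ∀ t ∈ U, HasDerivAt h (ρ t) t) (hLv : ∀ t ∈ U, L (v t) = ρ t • v (h t)) {t : ℝ}
    (ht : t ∈ U) : (δ - 2 * τ ^ 2 / 9) * (1 - ρ t ^ 2) = 0 := by
  have hAv : ∀ t, HasDerivAt (fun s => A (v s)) (A (A (v t))) t := fun t =>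
    A.hasFDerivAt.comp_hasDerivAt t (hv t)
  have hvh : ∀ t ∈ U, HasDerivAt (fun s => v (h s)) (ρ t • A (v (h t))) t := fun t ht =>
    (hv (h t)).scomp t (hh t ht)
  have hAvh : ∀ t ∈ U, HasDerivAt (fun s => A (v (h s))) (ρ t • A (A (v (h t)))) t := fun t ht =>
    (hAv (h t)).scomp t (hh t ht)
  have hLv' : ∀ t, HasDerivAt (fun s => L (v s)) (L (A (v t))) t := fun t =>
    L.hasFDerivAt.comp_hasDerivAt t (hv t)
  have hLAv : ∀ t, HasDerivAt (fun s => L (A (v s))) (L (A (A (v t)))) t := fun t =>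
    L.hasFDerivAt.comp_hasDerivAt t (hAv t)
  have hρ0 : ∀ t ∈ U, ρ t ≠ 0 := by
    intro t ht h0
    have h1 := hLv t ht
    rw [h0, zero_smul] at h1
    apply hw t
    rw [hL _ h1]; simp [cross]
  -- The rate `ρ` and its derivative are quotients of area forms of differentiable curves, which
  -- supplies the smoothness needed to differentiate `hLv` twice.
  have hquot : ∀ (g : ℝ → ℝ) (e : ℝ → ℂ), (∀ t, DifferentiableAt ℝ e t) →
      (∀ t ∈ U, cross (e t) (A (v (h t))) = g t * cross (v (h t)) (A (v (h t)))) →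
      ∀ t ∈ U, HasDerivAt g (deriv g t) t := by
    intro g e he hg t ht
    have h1 : DifferentiableAt ℝ (fun t => cross (e t) (A (v (h t))) /
        cross (v (h t)) (A (v (h t)))) t :=
      ((he t).hasDerivAt.cross (hAvh t ht)).differentiableAt.div
        ((hvh t ht).cross (hAvh t ht)).differentiableAt (hw (h t))
    refine (h1.congr_of_eventuallyEq ?_).hasDerivAt
    filter_upwards [hU.mem_nhds ht] with s hs
    rw [hg s hs, mul_div_cancel_right₀ _ (hw (h s))]
  have hρ : ∀ t ∈ U, HasDerivAt ρ (deriv ρ t) t :=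
    hquot ρ _ (fun t => (hLv' t).differentiableAt) fun t ht => by
      rw [hLv t ht, cross_smul_left]
  set σ := deriv ρ with hσdef
  have hLA : ∀ t ∈ U, L (A (v t)) = ρ t • ρ t • A (v (h t)) + σ t • v (h t) := fun t ht => by
    refine (hLv' t).unique (((hρ t ht).smul (hvh t ht)).congr_of_eventuallyEq ?_)
    filter_upwards [hU.mem_nhds ht] with s hs using hLv s hs
  have hσ : ∀ t ∈ U, HasDerivAt σ (deriv σ t) t :=
    hquot σ _ (fun t => (hLAv t).differentiableAt) fun t ht => by
      rw [hLA t ht, cross_add_left, cross_smul_left, cross_smul_left, cross_smul_left, cross_self]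
      ring
  have hLAA : ∀ t ∈ U, L (A (A (v t))) = ρ t • (ρ t • ρ t • A (A (v (h t))) + σ t • A (v (h t))) +
      σ t • ρ t • A (v (h t)) + (σ t • ρ t • A (v (h t)) + deriv σ t • v (h t)) := fun t ht => by
    refine (hLAv t).unique ((((hρ t ht).smul ((hρ t ht).smul (hAvh t ht))).add
      ((hσ t ht).smul (hvh t ht))).congr_of_eventuallyEq ?_)
    filter_upwards [hU.mem_nhds ht] with s hs using hLA s hs
  -- Two expressions for `L (A (A v))`. Their coefficients at `A (v (h t))` determine `σ`; those at
  -- `v (h t)` then give the claim.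
  have hexp : ∀ t ∈ U, τ • (ρ t • ρ t • A (v (h t)) + σ t • v (h t)) - δ • ρ t • v (h t) =
      ρ t • (ρ t • ρ t • (τ • A (v (h t)) - δ • v (h t)) + σ t • A (v (h t))) +
      σ t • ρ t • A (v (h t)) + (σ t • ρ t • A (v (h t)) + deriv σ t • v (h t)) := fun t ht => by
    rw [← hLA t ht, ← hLv t ht, ← hA, ← hLAA t ht, hA, map_sub, map_smul, map_smul]
  have hsub : ∀ x y z, cross x (y - z) = cross x y - cross x z := fun x y z => by
    simp only [cross, Complex.sub_re, Complex.sub_im]; ring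
  have hσρ : ∀ t ∈ U, σ t = τ * (ρ t * (1 - ρ t)) / 3 := fun t ht => by
    have h1 := congrArg (cross (v (h t))) (hexp t ht)
    simp only [cross_add_right, hsub, cross_smul_right, cross_self] at h1
    have h2 : ρ t * cross (v (h t)) (A (v (h t))) * (σ t - τ * (ρ t * (1 - ρ t)) / 3) = 0 := by
      linear_combination (-1 / 3) * h1
    have := (mul_eq_zero.1 h2).resolve_left (mul_ne_zero (hρ0 t ht) (hw (h t)))
    linarith
  have hσ' : deriv σ t = τ * (σ t * (1 - ρ t) + ρ t * (-σ t)) / 3 := by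
    refine (hσ t ht).unique ((((((hρ t ht).mul ((hρ t ht).const_sub 1)).const_mul τ).div_const
      3)).congr_of_eventuallyEq ?_)
    filter_upwards [hU.mem_nhds ht] with s hs using hσρ s hs
  have h1 := congrArg (cross (A (v (h t)))) (hexp t ht)
  simp only [cross_add_right, hsub, cross_smul_right, cross_self] at h1
  rw [hσ', cross_swap (A _), hσρ t ht] at h1
  have h2 : ρ t * cross (v (h t)) (A (v (h t))) * ((δ - 2 * τ ^ 2 / 9) * (1 - ρ t ^ 2)) = 0 := by
    linear_combination h1
  exact (mul_eq_zero.1 h2).resolve_left (mul_ne_zero (hρ0 t ht) (hw (h t)))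

lemma hasStrictDerivAt_flow (X : AffField) (q : ℂ) (t : ℝ) :
    HasStrictDerivAt (fun t => flow X t q) (fld X (flow X t q)) t :=
  hasStrictDerivAt_of_hasDerivAt_of_continuousAt
    (Eventually.of_forall fun s => hasDerivAt_flow X q s)
    (hasDerivAt_fld_flow X q t).continuousAt

/-- A nondegenerate arc of a flow line, mapped properly into itself by an affine map, lies on a flow
line of a field with special linear part. -/
lemma det_eq_of_mapsTo {X : AffField} {q : ℂ} {α β τ δ : ℝ} (hαβ : α < β)
    (hinj : InjOn (fun t => flow X t q) (Icc α β)) (hA : ∀ z, X.1 (X.1 z) = τ • X.1 z - δ • z)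
    (hw : ∀ t, cross (fld X (flow X t q)) (X.1 (fld X (flow X t q))) ≠ 0) (S : ℂ ≃ᵃ[ℝ] ℂ)
    (hS : S '' ((fun t => flow X t q) '' Icc α β) ⊂ (fun t => flow X t q) '' Icc α β) :
    δ = 2 * τ ^ 2 / 9 := by
  have hΓc : Continuous fun t => flow X t q :=
    continuous_iff_continuousAt.2 fun t => (hasDerivAt_flow X q t).continuousAt
  obtain ⟨h, hc, hm, he⟩ := exists_lift_arc hΓc.continuousOn hinj (T := Icc α β)
    (e := fun t => S (flow X t q)) ((continuous_affine S).comp hΓc).continuousOn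
    (fun t ht => hS.1 (mem_image_of_mem S (mem_image_of_mem _ ht)))
  have hSd : ∀ t, HasDerivAt (fun t => S (flow X t q)) (lin S (fld X (flow X t q))) t := fun t => by
    have h1 : (fun t => S (flow X t q)) = fun t => lin S (flow X t q) + S 0 :=
      funext fun t => apply_eq_lin_add S _
    rw [h1]
    exact ((lin S : ℂ →L[ℝ] ℂ).hasFDerivAt.comp_hasDerivAt t (hasDerivAt_flow X q t)).add_const _
  have hne : ∀ t, fld X (flow X t q) ≠ 0 := fun t h0 => hw t (by rw [h0]; simp [cross])
  have hev : ∀ t ∈ Ioo α β, ∀ᶠ s in 𝓝 t, flow X (h s) q = S (flow X s q) := fun t ht => by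
    filter_upwards [Ioo_mem_nhds ht.1 ht.2] with s hs using he s (Ioo_subset_Icc_self hs)
  have hd : ∀ t ∈ Ioo α β, HasDerivAt h (deriv h t) t := fun t ht =>
    (differentiableAt_of_comp (hasStrictDerivAt_flow X q (h t)) (hne _) (hSd t).differentiableAt
      (hc.continuousAt (Icc_mem_nhds ht.1 ht.2)) (hev t ht)).hasDerivAt
  have hLv : ∀ t ∈ Ioo α β, (lin S : ℂ →L[ℝ] ℂ) (fld X (flow X t q)) =
      deriv h t • fld X (flow X (h t) q) := fun t ht =>
    (hSd t).unique (((hasDerivAt_flow X q (h t)).scomp t (hd t ht)).congr_of_eventuallyEq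
      ((hev t ht).mono fun s hs => hs.symm))
  by_contra hδ
  have hrate : ∀ t ∈ Ioo α β, deriv h t ^ 2 = 1 := fun t ht => by
    have := rate_eq (L := (lin S : ℂ →L[ℝ] ℂ)) (fun z hz => (lin S).map_eq_zero_iff.1 hz) hA
      (hasDerivAt_fld_flow X q) hw isOpen_Ioo hd hLv ht
    have := (mul_eq_zero.1 this).resolve_left (sub_ne_zero.2 hδ)
    linarith
  -- A chord of slope `±1` makes `h` map `[α, β]` onto itself, so the image under `S` would not be
  -- proper.
  obtain ⟨ξ, hξ, hslope⟩ := exists_hasDerivAt_eq_slope h (deriv h) hαβ hc hd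
  have h1 := hrate ξ hξ
  have hα := hm (left_mem_Icc.2 hαβ.le)
  have hβ := hm (right_mem_Icc.2 hαβ.le)
  have hi : InjOn h (Icc α β) := injOn_of_lift (c := fun t => flow X t q)
    (fun s hs t ht e => hinj hs ht (S.injective e)) he
  have hsurj : h '' Icc α β = Icc α β := by
    rw [image_Icc_eq_uIcc hαβ.le hc hi]
    rcases mul_self_eq_one_iff.1 ((sq _).symm.trans h1) with h2 | h2
    all_goals
      rw [hslope, div_eq_iff (by linarith)] at h2
    · rw [uIcc_of_le (by linarith)]
      congr 1 <;> linarith [hα.1, hα.2, hβ.1, hβ.2]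
    · rw [uIcc_of_ge (by linarith)]
      congr 1 <;> linarith [hα.1, hα.2, hβ.1, hβ.2]
  apply hS.2
  rintro _ ⟨t, ht, rfl⟩
  obtain ⟨s, hs, rfl⟩ := hsurj.ge ht
  exact ⟨_, mem_image_of_mem _ hs, (he s hs).symm⟩

/-- An arc of a parabola in the complex plane. -/
def IsParabola (γ : Set ℂ) : Prop :=
  ∃ p u v : ℂ, LinearIndependent ℝ ![u, v] ∧ ∃ a b : ℝ, a < b ∧
    γ = (fun t : ℝ => p + t • u + t ^ 2 • v) '' Icc a b

/-- The Taylor expansion of the flow stops after the quadratic term. -/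
lemma isParabola_of_nilpotent {X : AffField} {q : ℂ} {α β : ℝ} (hαβ : α < β)
    (hA : ∀ z, X.1 (X.1 z) = 0) (hw : cross (fld X q) (X.1 (fld X q)) ≠ 0) :
    IsParabola ((fun t => flow X t q) '' Icc α β) := by
  set v := fld X q with hv
  refine ⟨q, v, (1 / 2 : ℝ) • X.1 v, linearIndependent_of_cross ?_, α, β, hαβ,
    image_congr fun t _ => ?_⟩
  · rw [cross_smul_right]
    exact mul_ne_zero (by norm_num) hw
  · have := eq_flow_of_hasDerivAt (X := X) (c := fun t => q + t • v + t ^ 2 • (1 / 2 : ℝ) • X.1 v)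
      (fun t => by
        refine ((((hasDerivAt_id t).smul_const v).const_add q).add
          ((hasDerivAt_pow 2 t).smul_const _)).congr_deriv ?_
        simp only [fld, map_add, map_smul, hA]
        have h2 : X.1 q = v - X.2 := by rw [hv]; simp [fld]
        rw [h2]
        simp only [Nat.cast_ofNat, smul_zero]
        module) t
    simpa using this.symm

/-- The eigenvalues are `κ` and `2κ`, with eigenvectors `a` and `b` scaled so that `v = κ a + 2κ b`.
The flow line is then quadratic in `exp (κ t)`. -/
lemma isParabola_of_resonant {X : AffField} {q : ℂ} {α β κ : ℝ} (hαβ : α < β) (hκ : κ ≠ 0)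
    (hA : ∀ z, X.1 (X.1 z) = (3 * κ) • X.1 z - (2 * κ ^ 2) • z)
    (hw : cross (fld X q) (X.1 (fld X q)) ≠ 0) :
    IsParabola ((fun t => flow X t q) '' Icc α β) := by
  set v := fld X q with hv
  set a := (1 / κ ^ 2) • ((2 * κ) • v - X.1 v) with ha
  set b := (1 / (2 * κ ^ 2)) • (X.1 v - κ • v) with hb
  have hAa : X.1 a = κ • a := by
    rw [ha, map_smul, map_sub, map_smul, hA]
    match_scalars <;> field_simp <;> ring
  have hAb : X.1 b = (2 * κ) • b := by
    rw [hb, map_smul, map_sub, map_smul, hA]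
    match_scalars <;> field_simp <;> ring
  have hab : v = κ • a + (2 * κ) • b := by
    rw [ha, hb]
    match_scalars <;> field_simp <;> ring
  have hflow : ∀ t, flow X t q = (q - a - b) + Real.exp (κ * t) • a + Real.exp (κ * t) ^ 2 • b := by
    intro t
    have hexp : ∀ t, HasDerivAt (fun t => Real.exp (κ * t)) (Real.exp (κ * t) * (κ * 1)) t :=
      fun t => ((hasDerivAt_id t).const_mul κ).exp
    have := eq_flow_of_hasDerivAt (X := X) (c := fun t => (q - a - b) + Real.exp (κ * t) • a +
      Real.exp (κ * t) ^ 2 • b) (fun t => by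
        refine ((((hexp t).smul_const a).const_add _).add
          (((hexp t).pow 2).smul_const b)).congr_deriv ?_
        have h2 : X.1 q = v - X.2 := by rw [hv]; simp [fld]
        simp only [fld, map_add, map_sub, map_smul, hAa, hAb, h2, hab]
        simp only [Nat.cast_ofNat, Nat.add_one_sub_one, pow_one]
        module) t
    rw [this]
    simp only [mul_zero, Real.exp_zero, one_smul, one_pow]
    congr 1
    ring
  have himg := image_Icc_eq_uIcc hαβ.le (k := fun t => Real.exp (κ * t)) (by fun_prop)
    (fun s _ t _ e => mul_left_cancel₀ hκ (Real.exp_injective e))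
  have hne : Real.exp (κ * α) ≠ Real.exp (κ * β) := fun e =>
    hαβ.ne (mul_left_cancel₀ hκ (Real.exp_injective e))
  refine ⟨q - a - b, a, b, linearIndependent_of_cross ?_, _, _, min_lt_max.2 hne, ?_⟩
  · have : cross a b = (1 / (2 * κ ^ 3)) * cross v (X.1 v) := by
      simp only [ha, hb, cross, Complex.smul_re, Complex.smul_im, Complex.sub_re, Complex.sub_im,
        smul_eq_mul]
      field_simp; ring
    rw [this]
    exact mul_ne_zero (by positivity) hw
  · change _ = _ '' uIcc (Real.exp (κ * α)) (Real.exp (κ * β))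
    rw [← himg, ← image_comp]
    exact image_congr fun t _ => hflow t

/-- An arc of a flow line, mapped properly into itself by an affine map, is contained in a line or
is an arc of a parabola. -/
theorem inLine_or_isParabola {X : AffField} {q : ℂ} {α β : ℝ} (hαβ : α < β)
    (hinj : InjOn (fun t => flow X t q) (Icc α β)) (S : ℂ ≃ᵃ[ℝ] ℂ)
    (hS : S '' ((fun t => flow X t q) '' Icc α β) ⊂ (fun t => flow X t q) '' Icc α β) :
    InLine ((fun t => flow X t q) '' Icc α β) ∨ IsParabola ((fun t => flow X t q) '' Icc α β) := by
  obtain ⟨τ, δ, hA⟩ := exists_cayleyHamilton X.1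
  by_cases hw0 : cross (fld X q) (X.1 (fld X q)) = 0
  · exact Or.inl (inLine_orbit (fld_ne_zero_of_injOn hαβ hinj) hw0 _)
  right
  -- This area satisfies `y' = τ y`, so it vanishes everywhere or nowhere.
  have hw : ∀ t, cross (fld X (flow X t q)) (X.1 (fld X (flow X t q))) ≠ 0 := by
    intro t
    have h1 := eq_mul_exp_of_hasDerivAt
      (y := fun t => cross (fld X (flow X t q)) (X.1 (fld X (flow X t q)))) (μ := τ) (fun t => by
        have hv := hasDerivAt_fld_flow X q t
        refine (hv.cross (X.1.hasFDerivAt.comp_hasDerivAt t hv)).congr_deriv ?_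
        simp only [Function.comp_apply]
        rw [hA, cross_self, sub_eq_add_neg, ← neg_smul, cross_add_right, cross_smul_right,
          cross_smul_right, cross_self]
        ring) t
    simp only [flow_zero] at h1
    rw [h1]
    exact mul_ne_zero hw0 (Real.exp_pos _).ne'
  have hδ := det_eq_of_mapsTo hαβ hinj hA hw S hS
  by_cases hτ : τ = 0
  · refine isParabola_of_nilpotent hαβ (fun z => ?_) hw0
    rw [hA, hδ, hτ]; simp
  · refine isParabola_of_resonant (κ := τ / 3) hαβ (by simpa using hτ) (fun z => ?_) hw0
    rw [hA, hδ]
    module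


/-! ### The collinear case and the classification in `ℂ`. -/

lemma exists_eq_segment_of_inLine {φ : ℝ → ℂ} (hφ : Continuous φ) (hinj : InjOn φ (Icc 0 1))
    (hl : InLine (φ '' Icc 0 1)) : ∃ p q : ℂ, p ≠ q ∧ φ '' Icc 0 1 = segment ℝ p q := by
  obtain ⟨l, hl0, c, hc⟩ := hl
  have h0 : (0 : ℝ) ∈ Icc (0 : ℝ) 1 := ⟨le_rfl, zero_le_one⟩
  have h1 : (1 : ℝ) ∈ Icc (0 : ℝ) 1 := ⟨zero_le_one, le_rfl⟩
  have hne : φ 0 ≠ φ 1 := fun e => zero_ne_one (hinj h0 h1 e)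
  set e := φ 1 - φ 0 with he
  have hn : e.re ^ 2 + e.im ^ 2 ≠ 0 := by
    intro h
    apply hne
    refine (sub_eq_zero.1 (?_ : e = 0)).symm
    apply Complex.ext
    · simp only [Complex.zero_re]; nlinarith [sq_nonneg e.re, sq_nonneg e.im]
    · simp only [Complex.zero_im]; nlinarith [sq_nonneg e.re, sq_nonneg e.im]
  have hlz : ∀ z, l z = z.re * l 1 + z.im * l Complex.I := fun z => by
    rw [← smul_eq_mul, ← smul_eq_mul, ← map_smul, ← map_smul, ← map_add]
    congr 1
    apply Complex.ext <;> simp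
  have hcross : ∀ s ∈ Icc (0 : ℝ) 1, cross e (φ s - φ 0) = 0 := by
    intro s hs
    have e1 : l e = 0 := by
      rw [he, map_sub, hc _ (mem_image_of_mem _ h0), hc _ (mem_image_of_mem _ h1), sub_self]
    have e2 : l (φ s - φ 0) = 0 := by
      rw [map_sub, hc _ (mem_image_of_mem _ h0), hc _ (mem_image_of_mem _ hs), sub_self]
    rw [hlz] at e1 e2
    by_contra hcon
    have f1 : cross e (φ s - φ 0) * l 1 = 0 := by
      unfold cross; linear_combination (φ s - φ 0).im * e1 - e.im * e2
    have f2 : cross e (φ s - φ 0) * l Complex.I = 0 := by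
      unfold cross; linear_combination e.re * e2 - (φ s - φ 0).re * e1
    apply hl0
    ext z
    rw [hlz, (mul_eq_zero.1 f1).resolve_left hcon, (mul_eq_zero.1 f2).resolve_left hcon]
    simp
  set x : ℝ → ℝ := fun s => (e.re * (φ s - φ 0).re + e.im * (φ s - φ 0).im) /
    (e.re ^ 2 + e.im ^ 2) with hx
  have hφx : ∀ s ∈ Icc (0 : ℝ) 1, φ s = φ 0 + x s • e := by
    intro s hs
    have h2 := hcross s hs
    unfold cross at h2
    rw [← sub_eq_iff_eq_add']
    apply Complex.ext
    · simp only [hx, Complex.smul_re, smul_eq_mul]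
      field_simp
      linear_combination (-e.im) * h2
    · simp only [hx, Complex.smul_im, smul_eq_mul]
      field_simp
      linear_combination e.re * h2
  have hxc : Continuous x := by
    have hre := Complex.continuous_re.comp (hφ.sub (continuous_const (y := φ 0)))
    have him := Complex.continuous_im.comp (hφ.sub (continuous_const (y := φ 0)))
    exact ((continuous_const.mul hre).add (continuous_const.mul him)).div_const _
  have hxi : InjOn x (Icc 0 1) := fun s hs t ht hst =>
    hinj hs ht (by rw [hφx s hs, hφx t ht, hst])
  have himg := image_Icc_eq_uIcc zero_le_one hxc.continuousOn hxi
  have hx0 : x 0 = 0 := by simp [hx]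
  have hx1 : x 1 = 1 := by
    simp only [hx]
    rw [← he, div_eq_one_iff_eq hn]; ring
  rw [hx0, hx1, uIcc_of_le zero_le_one] at himg
  refine ⟨φ 0, φ 1, hne, ?_⟩
  refine (image_congr hφx).trans ?_
  rw [segment_eq_image']
  conv_rhs => rw [← himg, image_image]

/-- Arcs with small affine copies everywhere and with almost coinciding affine copies. -/
theorem isParabola_or_segment {φ : ℝ → ℂ} (hφ : Continuous φ) (hinj : InjOn φ (Icc 0 1))
    (hself : ∀ p ∈ φ '' Icc 0 1, ∀ ε > 0,
      ∃ g : ℂ ≃ᵃ[ℝ] ℂ, g '' (φ '' Icc 0 1) ⊆ φ '' Icc 0 1 ∩ ball p ε)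
    {i j f : ℕ → ℂ ≃ᵃ[ℝ] ℂ} (hi : ∀ n, MapsTo (i n) (φ '' Icc 0 1) (φ '' Icc 0 1))
    (hj : ∀ n, MapsTo (j n) (φ '' Icc 0 1) (φ '' Icc 0 1)) (hf : ∀ n z, j n (f n z) = i n z)
    (hne : ∀ n, f n ≠ 1) (hlim : ∀ z, Tendsto (fun n => f n z) atTop (𝓝 z))
    (hmeet : ∀ n, (f n '' (φ '' Icc 0 1) ∩ φ '' Icc 0 1).Nonempty) :
    IsParabola (φ '' Icc 0 1) ∨ ∃ p q : ℂ, p ≠ q ∧ φ '' Icc 0 1 = segment ℝ p q := by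
  by_cases hl : InLine (φ '' Icc 0 1)
  · exact Or.inr (exists_eq_segment_of_inLine hφ hinj hl)
  left
  have horb := (inLine_or_hasOrbitSubarc hφ hinj hi hj hf hne hlim (fun n => by
    obtain ⟨_, ⟨_, ⟨s, hs, rfl⟩, rfl⟩, h⟩ := hmeet n
    exact ⟨s, hs, h⟩)).resolve_left hl
  have h0 : (0 : ℝ) ∈ Icc (0 : ℝ) 1 := ⟨le_rfl, zero_le_one⟩
  have h1 : (1 : ℝ) ∈ Icc (0 : ℝ) 1 := ⟨zero_le_one, le_rfl⟩
  have hdist : 0 < dist (φ 1) (φ 0) := dist_pos.2 fun e => one_ne_zero (hinj h1 h0 e)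
  -- A copy of the arc inside this ball around `φ 0` misses `φ 1`, hence is proper.
  obtain ⟨S, hS⟩ := hself _ (mem_image_of_mem φ h0) _ hdist
  have hS' : S '' (φ '' Icc 0 1) ⊂ φ '' Icc 0 1 :=
    ⟨hS.trans inter_subset_left, fun h =>
      lt_irrefl _ (mem_ball.1 (hS (h (mem_image_of_mem φ h1))).2)⟩
  obtain ⟨X, q, α, β, hαβ, hΓ, heq⟩ := exists_eq_orbit hφ hinj hself horb
  rw [heq] at hl hS' ⊢
  exact (inLine_or_isParabola hαβ hΓ S hS').resolve_left hl

end AffField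

/-! ### Words and small pieces of the attractor. -/

section Words

variable {m : ℕ} {S : Fin m → (Plane ≃ᵃ[ℝ] Plane)} {γ : Set Plane}

lemma wordMap_nil (x : Plane) : wordMap S [] x = x := rfl

lemma wordMap_cons (a : Fin m) (w : List (Fin m)) (x : Plane) :
    wordMap S (a :: w) x = S a (wordMap S w x) := by
  simp [wordMap, AffineEquiv.mul_def]

lemma IsAttractor.mapsTo_wordMap (h : IsAttractor S γ) (w : List (Fin m)) :
    MapsTo (wordMap S w) γ γ := by
  induction w with
  | nil => exact fun x hx => hx
  | cons a w ih =>
    intro x hx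
    rw [wordMap_cons, h.2.2]
    exact mem_iUnion.2 ⟨a, mem_image_of_mem _ (ih hx)⟩

lemma IsAttractor.exists_wordMap_eq (h : IsAttractor S γ) (n : ℕ) :
    ∀ p ∈ γ, ∃ w : List (Fin m), w.length = n ∧ ∃ x ∈ γ, wordMap S w x = p := by
  induction n with
  | zero => exact fun p hp => ⟨[], rfl, p, hp, rfl⟩
  | succ n ih =>
    intro p hp
    rw [h.2.2] at hp
    obtain ⟨a, y, hy, rfl⟩ := mem_iUnion.1 hp
    obtain ⟨w, hw, x, hx, rfl⟩ := ih y hy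
    exact ⟨a :: w, by simp [hw], x, hx, wordMap_cons a w x⟩

/-- The common constant is the largest of the finitely many; for `m = 0` the supremum is 0. -/
lemma exists_dist_wordMap_le (hS : ∀ a, ∃ K : NNReal, ContractingWith K (S a)) :
    ∃ K : NNReal, K < 1 ∧ ∀ w x y,
      dist (wordMap S w x) (wordMap S w y) ≤ (K : ℝ) ^ w.length * dist x y := by
  choose K hK using hS
  refine ⟨Finset.univ.sup K, (Finset.sup_lt_iff (by simp)).2 fun a _ => (hK a).1, fun w x y => ?_⟩
  induction w with
  | nil => simp [wordMap_nil]
  | cons a w ih =>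
    rw [wordMap_cons, wordMap_cons, List.length_cons, pow_succ', mul_assoc]
    have h1 : (K a : ℝ) ≤ (Finset.univ.sup K : NNReal) :=
      NNReal.coe_le_coe.2 (Finset.le_sup (Finset.mem_univ a))
    exact ((hK a).2.dist_le_mul _ _).trans (mul_le_mul h1 ih dist_nonneg (NNReal.coe_nonneg _))

/-- The pieces of an attractor shrink to points. -/
lemma IsAttractor.exists_wordMap_image_subset (h : IsAttractor S γ)
    (hS : ∀ a, ∃ K : NNReal, ContractingWith K (S a)) {p : Plane} (hp : p ∈ γ) {ε : ℝ}
    (hε : 0 < ε) : ∃ w : List (Fin m), wordMap S w '' γ ⊆ γ ∩ ball p ε := by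
  obtain ⟨K, hK1, hK⟩ := exists_dist_wordMap_le hS
  have hlim : Tendsto (fun n => (K : ℝ) ^ n * diam γ) atTop (𝓝 0) := by
    simpa using (tendsto_pow_atTop_nhds_zero_of_lt_one K.coe_nonneg
      (by exact_mod_cast hK1)).mul_const (diam γ)
  obtain ⟨n, hn⟩ := (hlim.eventually (gt_mem_nhds hε)).exists
  obtain ⟨w, rfl, x, hx, rfl⟩ := h.exists_wordMap_eq n p hp
  refine ⟨w, ?_⟩
  rintro _ ⟨y, hy, rfl⟩
  refine ⟨h.mapsTo_wordMap w hy, mem_ball.2 ?_⟩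
  calc dist (wordMap S w y) (wordMap S w x) ≤ (K : ℝ) ^ w.length * dist y x := hK w y x
    _ ≤ (K : ℝ) ^ w.length * diam γ := by
      gcongr
      exact dist_le_diam_of_mem h.2.1.isBounded hy hx
    _ < ε := hn

end Words

/-! ### Transfer between the Euclidean plane and `ℂ`. -/

/-- The complex plane as a model of the Euclidean plane. -/
def planeEquiv : ℂ ≃ₗᵢ[ℝ] Plane := Complex.orthonormalBasisOneI.repr

/-- Affine maps of the Euclidean plane in the complex coordinate. -/
def toComplexAffine (g : Plane ≃ᵃ[ℝ] Plane) : ℂ ≃ᵃ[ℝ] ℂ :=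
  (planeEquiv.toLinearEquiv.toAffineEquiv.trans g).trans
    planeEquiv.toLinearEquiv.toAffineEquiv.symm

lemma toComplexAffine_apply (g : Plane ≃ᵃ[ℝ] Plane) (z : ℂ) :
    toComplexAffine g z = planeEquiv.symm (g (planeEquiv z)) := rfl

lemma toComplexAffine_image (g : Plane ≃ᵃ[ℝ] Plane) (γ : Set Plane) :
    toComplexAffine g '' (planeEquiv.symm '' γ) = planeEquiv.symm '' (g '' γ) := by
  simp only [image_image, toComplexAffine_apply, LinearIsometryEquiv.apply_symm_apply]

lemma isParabolaArc_of_isParabola {γ : Set Plane} (h : AffField.IsParabola (planeEquiv.symm '' γ)) :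
    IsParabolaArc γ := by
  obtain ⟨p, u, v, huv, a, b, hab, e⟩ := h
  refine ⟨planeEquiv p, planeEquiv u, planeEquiv v, ?_, a, b, hab, ?_⟩
  · rw [LinearIndependent.pair_iff] at huv ⊢
    intro s t hst
    apply huv s t
    apply planeEquiv.injective
    rw [map_add, map_smul, map_smul, hst, map_zero]
  · have h1 := congrArg (fun s => planeEquiv '' s) e
    simp only [image_image, LinearIsometryEquiv.apply_symm_apply, image_id', map_add, map_smul] at h1
    exact h1

lemma isLineSegment_of_eq_segment {γ : Set Plane} {p q : ℂ} (hpq : p ≠ q)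
    (h : planeEquiv.symm '' γ = segment ℝ p q) : IsLineSegment γ := by
  refine ⟨planeEquiv p, planeEquiv q, planeEquiv.injective.ne hpq, ?_⟩
  have h1 := congrArg (fun s => planeEquiv '' s) h
  simp only [image_image, LinearIsometryEquiv.apply_symm_apply, image_id'] at h1
  rw [h1]
  exact image_segment ℝ planeEquiv.toLinearEquiv.toLinearMap.toAffineMap p q

lemma IsJordanArc.exists_parametrization {γ : Set Plane} (h : IsJordanArc γ) :
    ∃ φ : ℝ → ℂ, Continuous φ ∧ InjOn φ (Icc 0 1) ∧ φ '' Icc 0 1 = planeEquiv.symm '' γ := by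
  obtain ⟨c, hc, hi, rfl⟩ := h
  refine ⟨fun t => planeEquiv.symm (c (projIcc 0 1 zero_le_one t)),
    planeEquiv.symm.continuous.comp (hc.comp continuous_projIcc), ?_, ?_⟩
  · intro s hs t ht e
    have := hi (planeEquiv.symm.injective e)
    rw [projIcc_of_mem _ hs, projIcc_of_mem _ ht] at this
    exact congrArg Subtype.val this
  · ext z
    constructor
    · rintro ⟨t, _, rfl⟩
      exact mem_image_of_mem _ (mem_range_self _)
    · rintro ⟨_, ⟨t, rfl⟩, rfl⟩
      refine ⟨t, t.2, ?_⟩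
      simp only
      rw [projIcc_of_mem _ t.2]

theorem theorem3 (γ : Set Plane) (hγ : IsJordanArc γ)
    (m : ℕ) (S : Fin m → (Plane ≃ᵃ[ℝ] Plane))
    (hS : ∀ i, ∃ K : NNReal, ContractingWith K (S i))
    (hatt : IsAttractor S γ)
    (f : ℕ → (Plane ≃ᵃ[ℝ] Plane))
    (hfS : ∀ n, f n ∈ associatedFamily S \ {1})
    (hf : ∀ x, Filter.Tendsto (fun n => f n x) Filter.atTop (nhds x))
    (hmeet : ∀ n, ((f n) '' γ ∩ γ).Nonempty) :
    IsParabolicSegment γ := by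
  obtain ⟨φ, hφ, hinj, hφγ⟩ := hγ.exists_parametrization
  choose i₁ j₁ i j _ hij using fun n => (hfS n).1
  have hmaps : ∀ w : List (Fin m), MapsTo (toComplexAffine (wordMap S w)) (φ '' Icc 0 1)
      (φ '' Icc 0 1) := by
    intro w
    rw [hφγ, mapsTo_iff_image_subset, toComplexAffine_image]
    exact image_mono (hatt.mapsTo_wordMap w).image_subset
  have key := AffField.isParabola_or_segment hφ hinj
    (i := fun n => toComplexAffine (wordMap S (i₁ n :: i n)))
    (j := fun n => toComplexAffine (wordMap S (j₁ n :: j n)))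
    (f := fun n => toComplexAffine (f n)) ?_ (fun n => hmaps _) (fun n => hmaps _) ?_ ?_ ?_ ?_
  · rw [hφγ] at key
    rcases key with h | ⟨p, q, hpq, h⟩
    · exact Or.inl (isParabolaArc_of_isParabola h)
    · exact Or.inr (isLineSegment_of_eq_segment hpq h)
  · rw [hφγ]
    rintro _ ⟨p, hp, rfl⟩ ε hε
    obtain ⟨w, hw⟩ := hatt.exists_wordMap_image_subset hS hp hε
    refine ⟨toComplexAffine (wordMap S w), ?_⟩
    rw [toComplexAffine_image]
    rintro _ ⟨x, hx, rfl⟩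
    refine ⟨mem_image_of_mem _ (hw hx).1, ?_⟩
    rw [mem_ball, LinearIsometryEquiv.dist_map]
    exact (hw hx).2
  · intro n z
    have h1 : ∀ x, wordMap S (j₁ n :: j n) (f n x) = wordMap S (i₁ n :: i n) x := fun x => by
      rw [hij n]
      exact AffineEquiv.apply_symm_apply _ _
    simp only [toComplexAffine_apply, LinearIsometryEquiv.apply_symm_apply, h1]
  · intro n h
    apply (hfS n).2
    ext1 x
    have h1 := DFunLike.congr_fun h (planeEquiv.symm x)
    rw [toComplexAffine_apply, LinearIsometryEquiv.apply_symm_apply] at h1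
    exact planeEquiv.symm.injective h1
  · intro z
    have h1 := (planeEquiv.symm.continuous.tendsto _).comp (hf (planeEquiv z))
    rw [LinearIsometryEquiv.symm_apply_apply] at h1
    exact h1
  · intro n
    rw [hφγ, toComplexAffine_image, ← image_inter planeEquiv.symm.injective]
    exact (hmeet n).image _
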